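/- Let $s$ be an odd prime, $p=2\le q$, $n=p+q+1$. An $s^p\times s^q$ row-column design without replication places distinct level combinations $d[i,j]\in \mathrm{GF}(s)^n$ in the cells of an array with $s^p$ rows and $s^q$ columns. The observations follow the linear model $$Y_{ij}=\mu+\tau_i+\rho_j+\gamma_{d[i,j]}+\varepsilon_{ij},\qquad \gamma_{(x_1,\dots,x_n)}=\sum_{l}\alpha_{l,x_l}+\sum_{l<m}\sum_{v=1}^{s-1}\beta^{(v)}_{lm,\,x_l+vx_m},$$ with $\sum_u\alpha_{l,u}=0$, $\sum_u\beta^{(v)}_{lm,u}=0$ and uncorrelated errors of mean $0$ and variance $\sigma^2>0$. A main effect $F_l$ (parameters $\alpha_{l,u}$) or an interaction component $F_lF_m^v$ (parameters $\beta^{(v)}_{lm,u}$) is unconfounded if its parameters are estimable and their best linear unbiased estimators are uncorrelated with those of all estimable functions of the other parameters; the two-factor interaction $F_l\times F_m$ is unconfounded if $F_lF_m^v$ is so for all $v=1,\dots,s-1$. A design without replication is 2fi-optimal if all its main effects are unconfounded and it has the maximum number of unconfounded two-factor interactions among all $s^p\times s^q$ row-column designs without replication, with $n$ factors at $s$ levels,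 whose main effects are all unconfounded. The 2fi-efficiency of a design is the number of its unconfounded two-factor interactions divided by $$\phi(s,p,q,n)=\binom n2-N\binom\alpha2-\alpha\beta,\quad N=\frac{s^{\min(p,q)}-1}{s-1},\ \alpha=\lfloor n/N\rfloor,\ \beta=n-N\alpha .$$ A $(p+q)\times n$ matrix $\mathcal G$ over $\mathrm{GF}(s)$ with upper block $\mathcal G_c$ ($p$ rows) and lower block $\mathcal G_r$ ($q$ rows) yields the design whose cell $(z,w)$, $z\in \mathrm{GF}(s)^p$, $w\in \mathrm{GF}(s)^q$, receives $z\mathcal G_c+w\mathcal G_r$. In each of the following cases any four columns of $\mathcal G$ are linearly independent and $\mathcal G$ yields a 2fi-optimal $s^{n-1}$ fractional factorial row-column design. Its 2fi-efficiency is $8/9$ in case (a) with $s=3$ and $1$ in all other cases. (a) $q=2$: $\mathcal G=\begin{pmatrix} I_2&M&a\\ I_2&M+I_2&b\end{pmatrix}$, where $M=\begin{pmatrix}1&1\\2&1\end{pmatrix}$, $a=(1,2)^T$, $b=(2,0)^T$ if $s=3$, and $M=\begin{pmatrix}1&1\\3&2\end{pmatrix}$, $a=(1,1)^T$, $b=(2,2)^T$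 if $s>3$. In (b), (c), (d), $M=\begin{pmatrix}1&1\\2&1\end{pmatrix}$ and $e_i$ is the $i$-th unit vector in $\mathrm{GF}(s)^2$. (b) $q=3$: $\mathcal G=\begin{pmatrix} I_2&M&a&b\\ I_2&M+I_2&e_1&0\\ 0&0&1&1\end{pmatrix}$, where $a=(1,-2)^T$, $b=(1,-1)^T$. (c) $q=4$: $\mathcal G=\begin{pmatrix} I_2&M&a&b&c\\ I_2&M+I_2&e_2&0&0\\ 0&0&e_1+e_2&e_1+2e_2&e_2\end{pmatrix}$, where $a=(1,-1)^T$, $b=(1,-2)^T$, $c=(1,-3)^T$. (d) $q\ge5$: $\mathcal G=\begin{pmatrix} I_2&M&a&X\\ I_2&M+I_2&a&0\\ 0&0&\mathbf 1_{q-2}&I_{q-2}\end{pmatrix}$, where $a=(1,-1)^T$, $\mathbf 1_{q-2}$ is the all-ones column, and $X$ is any $2\times(q-2)$ matrix with nonzero columns such that each point of $\mathrm{PG}(1,s)$ occurs $\lfloor n/(s+1)\rfloor$ or $\lfloor n/(s+1)\rfloor+1$ times among the columns of $(I_2\mid M\mid a\mid X)$; such an $X$ exists. -/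

import Mathlib

open Matrix

noncomputable section

namespace FactorialDesign

/-! ### Row-column designs and treatment effects -/

/-- An `s ^ p × s ^ q` row-column array with `n` factors at `s` levels. The `s ^ p` rows are labelled
by `Fin p → ZMod s`, the `s ^ q` columns by `Fin q → ZMod s`, and `d i j` is the level combination
applied to the unit in row `i` and column `j`. -/
abbrev RowColumnDesign (s p q n : ℕ) : Type :=
  (Fin p → ZMod s) → (Fin q → ZMod s) → (Fin n → ZMod s)

/-- No level combination is used twice. -/
def RowColumnDesign.WithoutReplication {s p q n : ℕ} (d : RowColumnDesign s p q n) : Prop :=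
  Function.Injective fun k : (Fin p → ZMod s) × (Fin q → ZMod s) => d k.1 k.2

/-- The treatment effects of the model: the main effects `F_l`, and the components `F_l F_m ^ v`
(`l < m`, `v ≠ 0`) of the two-factor interactions. -/
abbrev Effect (s n : ℕ) : Type :=
  Fin n ⊕ {t : Fin n × Fin n × ZMod s // t.1 < t.2.1 ∧ t.2.2 ≠ 0}

/-- The main effect `F_l`. -/
def mainEffect (s : ℕ) {n : ℕ} (l : Fin n) : Effect s n := Sum.inl l

/-- The interaction component `F_l F_m ^ v`. -/
def component {s n : ℕ} (l m : Fin n) (v : ZMod s) (hlm : l < m) (hv : v ≠ 0) : Effect s n :=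
  Sum.inr ⟨(l, m, v), hlm, hv⟩

/-- The level of a treatment effect at the level combination `x`: it is `x_l` for `F_l`
and `x_l + v x_m` for `F_l F_m ^ v`. -/
def Effect.level {s n : ℕ} (x : Fin n → ZMod s) : Effect s n → ZMod s
  | Sum.inl l => x l
  | Sum.inr t => x t.1.1 + t.1.2.2 * x t.1.2.1

/-! ### The linear model -/

/-- Parameters of the model: overall mean, row effects, column effects, and for every treatment
effect `e` and level `u` a parameter `treat e u`, summing to zero over `u`. Thus
`treat (mainEffect s l) u` is `α_{l,u}` and `treat (component l m v _ _) u` is `β_{lm,u}^{(v)}`. -/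
structure Parameters (s p q n : ℕ) [NeZero s] where
  mean : ℝ
  row : (Fin p → ZMod s) → ℝ
  col : (Fin q → ZMod s) → ℝ
  treat : Effect s n → ZMod s → ℝ
  sum_treat : ∀ e, ∑ u, treat e u = 0

section Model

variable {s p q n : ℕ} [NeZero s]

/-- The expectation `μ + τ_i + ρ_j + γ_{d[i,j]}` of the observation `Y_{ij}`. -/
def expectedObs (d : RowColumnDesign s p q n) (θ : Parameters s p q n)
    (i : Fin p → ZMod s) (j : Fin q → ZMod s) : ℝ :=
  θ.mean + θ.row i + θ.col j + ∑ e : Effect s n, θ.treat e (Effect.level (d i j) e)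

/-- The coefficients `c` of a linear estimator `∑_{i,j} c i j * Y_{ij}`. -/
abbrev LinearEstimator (s p q : ℕ) : Type := (Fin p → ZMod s) → (Fin q → ZMod s) → ℝ

/-- The expectation of a linear estimator. -/
def expectation (d : RowColumnDesign s p q n) (θ : Parameters s p q n)
    (c : LinearEstimator s p q) : ℝ :=
  ∑ i, ∑ j, c i j * expectedObs d θ i j

/-- The covariance of the error terms of the units `k` and `k'`: the errors are uncorrelated and
all have variance `σ ^ 2`. -/
def errorCov (σ : ℝ) (k k' : (Fin p → ZMod s) × (Fin q → ZMod s)) : ℝ :=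
  if k = k' then σ ^ 2 else 0

/-- The covariance of two linear estimators. -/
def cov (σ : ℝ) (c c' : LinearEstimator s p q) : ℝ :=
  ∑ k : (Fin p → ZMod s) × (Fin q → ZMod s), ∑ k' : (Fin p → ZMod s) × (Fin q → ZMod s),
    c k.1 k.2 * c' k'.1 k'.2 * errorCov σ k k'

/-- `c` is a linear unbiased estimator of the parametric function `ψ`. -/
def IsUnbiased (d : RowColumnDesign s p q n) (c : LinearEstimator s p q)
    (ψ : Parameters s p q n → ℝ) : Prop :=
  ∀ θ, expectation d θ c = ψ θ

/-- `c` is the best linear unbiased (least squares) estimator of the parametric function `ψ`. -/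
def IsBLUE (σ : ℝ) (d : RowColumnDesign s p q n) (c : LinearEstimator s p q)
    (ψ : Parameters s p q n → ℝ) : Prop :=
  IsUnbiased d c ψ ∧ ∀ c', IsUnbiased d c' ψ → cov σ c c ≤ cov σ c' c'

/-- `ψ` is a function of the parameters other than those of the treatment effect `e`. -/
def DependsOnOthers (e : Effect s n) (ψ : Parameters s p q n → ℝ) : Prop :=
  ∀ θ θ' : Parameters s p q n, θ.mean = θ'.mean → θ.row = θ'.row → θ.col = θ'.col →
    (∀ e', e' ≠ e → θ.treat e' = θ'.treat e') → ψ θ = ψ θ'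

/-- The treatment effect `e` is unconfounded: its parameters have estimators in the model, and these
are uncorrelated with every estimator for the other parameters of the model (overall mean, row and
column effects, other main effects and interaction components). As some of the other effects may be
estimable only in combination, all estimable functions of the other parameters are considered. -/
def IsUnconfounded (σ : ℝ) (d : RowColumnDesign s p q n) (e : Effect s n) : Prop :=
  (∀ u, ∃ c, IsBLUE σ d c fun θ => θ.treat e u) ∧
    ∀ u c, (IsBLUE σ d c fun θ => θ.treat e u) →
      ∀ ψ c', DependsOnOthers e ψ → IsBLUE σ d c' ψ → cov σ c c' = 0

/-- All main effects are unconfounded. -/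
def MainEffectsUnconfounded (σ : ℝ) (d : RowColumnDesign s p q n) : Prop :=
  ∀ l, IsUnconfounded σ d (mainEffect s l)

/-- The interaction `F_l × F_m` is unconfounded if all its `s - 1` components are. -/
def InteractionUnconfounded (σ : ℝ) (d : RowColumnDesign s p q n) (l m : Fin n)
    (hlm : l < m) : Prop :=
  ∀ (v : ZMod s) (hv : v ≠ 0), IsUnconfounded σ d (component l m v hlm hv)

/-- The number of unconfounded two-factor interactions. -/
def numUnconfounded (σ : ℝ) (d : RowColumnDesign s p q n) : ℕ :=
  {t : Fin n × Fin n | ∃ h : t.1 < t.2, InteractionUnconfounded σ d t.1 t.2 h}.ncard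

/-- A row-column design without replication is 2fi-optimal if all its main effects are unconfounded
and, among all row-column designs with the same parameters that have these two properties,
it has the maximum number of unconfounded two-factor interactions. -/
structure IsTwoFiOptimal (σ : ℝ) (d : RowColumnDesign s p q n) : Prop where
  withoutReplication : d.WithoutReplication
  main : MainEffectsUnconfounded σ d
  maximum : ∀ d' : RowColumnDesign s p q n, d'.WithoutReplication → MainEffectsUnconfounded σ d' →
    numUnconfounded σ d' ≤ numUnconfounded σ d

end Model

/-! ### 2fi-efficiency -/

/-- The number `φ(s, p, q, n)`, that is `C(n, 2) - N C(α, 2) - α β` with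
`N = (s ^ min p q - 1) / (s - 1)`, `α = ⌊n / N⌋` and `β = n - N α`. -/
def phi (s p q n : ℕ) : ℤ :=
  let N : ℕ := (s ^ min p q - 1) / (s - 1)
  let α : ℕ := n / N
  let β : ℕ := n - N * α
  (n.choose 2 : ℤ) - N * (α.choose 2 : ℤ) - α * β

/-- The 2fi-efficiency: the number of unconfounded two-factor interactions over `φ(s, p, q, n)`. -/
def twoFiEfficiency {s p q n : ℕ} [NeZero s] (σ : ℝ) (d : RowColumnDesign s p q n) : ℚ :=
  numUnconfounded σ d / phi s p q n

/-! ### Array generator matrices -/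

/-- The design constructed from the array generator matrix with upper block `Gc` (`p` rows) and lower
block `Gr` (`q` rows): the first column block runs through the linear combinations `z ᵥ* Gc` of the
rows of `Gc`, the first row block through the linear combinations `w ᵥ* Gr` of the rows of `Gr`,
and the unit in row `z` and column `w` receives their sum. -/
def generatedDesign {s p q n : ℕ} (Gc : Matrix (Fin p) (Fin n) (ZMod s))
    (Gr : Matrix (Fin q) (Fin n) (ZMod s)) : RowColumnDesign s p q n :=
  fun z w => z ᵥ* Gc + w ᵥ* Gr

/-- Any four columns of the matrix with blocks `Gc` and `Gr` are linearly independent. -/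
def AnyFourColumnsIndependent {s p q n : ℕ} (Gc : Matrix (Fin p) (Fin n) (ZMod s))
    (Gr : Matrix (Fin q) (Fin n) (ZMod s)) : Prop :=
  ∀ t : Finset (Fin n), t.card = 4 →
    LinearIndependent (ZMod s) fun j : t => (Matrix.fromRows Gc Gr).col j

/-- The array generator matrix with blocks `Gc` and `Gr` has any four columns linearly independent
and yields a 2fi-optimal design of 2fi-efficiency `eff`. -/
structure YieldsOptimal {s p q n : ℕ} [NeZero s] (σ : ℝ) (Gc : Matrix (Fin p) (Fin n) (ZMod s))
    (Gr : Matrix (Fin q) (Fin n) (ZMod s)) (eff : ℚ) : Prop where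
  independent : AnyFourColumnsIndependent Gc Gr
  optimal : IsTwoFiOptimal σ (generatedDesign Gc Gr)
  efficiency : twoFiEfficiency σ (generatedDesign Gc Gr) = eff

/-! ### The matrices of case `q ≥ 5`, with `q = 2 + r` and `n = 5 + r` -/

/-- The upper block `(I₂ | M | a | X)` with `M = (1 1; 2 1)` and `a = (1, s - 1)ᵀ`. -/
def upperBlock {s r : ℕ} (X : Matrix (Fin 2) (Fin r) (ZMod s)) :
    Matrix (Fin 2) (Fin (5 + r)) (ZMod s) :=
  (Matrix.fromCols !![1, 0, 1, 1, 1; 0, 1, 2, 1, -1] X).submatrix id finSumFinEquiv.symm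

/-- The lower block, with rows `(I₂ | M + I₂ | a | 0)` above `(0 | 0 | 1 | I_r)`. -/
def lowerBlock (s r : ℕ) : Matrix (Fin (2 + r)) (Fin (5 + r)) (ZMod s) :=
  (Matrix.fromBlocks !![1, 0, 2, 1, 1; 0, 1, 2, 2, -1] 0
    (Matrix.of fun _ => ![0, 0, 0, 0, 1]) 1).submatrix finSumFinEquiv.symm finSumFinEquiv.symm

/-- The number of columns of `A` that belong to the point `P` of `PG(1, s)`. -/
def pointCount {s m : ℕ} [Fact s.Prime] (A : Matrix (Fin 2) (Fin m) (ZMod s))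
    (P : Projectivization (ZMod s) (Fin 2 → ZMod s)) : ℕ :=
  {j : Fin m | ∃ h : A.col j ≠ 0, Projectivization.mk (ZMod s) (A.col j) h = P}.ncard

/-- `X` is an admissible choice: its columns are nonzero, and every point of `PG(1, s)` occurs `α` or
`α + 1` times among the columns of `(I₂ | M | a | X)`, where `α = ⌊n / (s + 1)⌋`, `n = 5 + r`. -/
def IsAdmissible {s r : ℕ} [Fact s.Prime] (X : Matrix (Fin 2) (Fin r) (ZMod s)) : Prop :=
  (∀ j, X.col j ≠ 0) ∧ ∀ P, pointCount (upperBlock X) P = (5 + r) / (s + 1) ∨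
    pointCount (upperBlock X) P = (5 + r) / (s + 1) + 1

end FactorialDesign

end

/-! A best linear unbiased estimator is an unbiased one whose coefficient vector lies in the space
of expected observations (`isBLUE_iff`). Hence an effect is unconfounded exactly if its
contributions are orthogonal to those of all other parameters (`isUnconfounded_iff`), and everything
reduces to orthogonality of contrasts (`isOrthogonalEffect_iff`).

Upper bound: join two factors by an edge if their interaction is unconfounded. In one column of the
array, which has `s ^ 2` cells, two adjacent factors show every pair of levels exactly once. Then `s
+ 2` mutually adjacent factors would need `(s + 2) * (s - 1)` distinct cells other than a given one,
more than the `s ^ 2 - 1` available. So the graph has no clique of size `s + 2`, and Turán's theorem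
bounds its edges by `phi`, the size of the Turán graph with `s + 1` parts
(`numUnconfounded_le_phi`).

Attainment: in a generated design the level of an effect is a linear form in the labels of row and
column. Independence of any four columns makes the forms of different effects non-proportional,
hence their contrasts orthogonal. What remains is that the form depends on the row label and on the
column label. So `F_l × F_m` is unconfounded once columns `l` and `m` are independent in both
blocks. For `q ≥ 5` the lower block always satisfies this, and the upper one colours the factors by
the `s + 1` points of the projective line; a balanced colouring gives the Turán graph
(`phi_le_card_of_balanced`). The smaller cases are checked by integer minors.

Exception `s = 3`, `q = 2`: here `phi` is 9 but only 8 is possible (`numUnconfounded_le_eight`).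
With nine unconfounded interactions, four factors would be coordinates on the 81 cells and the
fifth, `b`, a Latin hypercube of order three, hence affine with nonzero coefficients. On each row
and each column this forces `b - δ * a` to be constant, where `a`, `b` is the remaining pair. It is
then constant on the whole array, which contradicts the nonzero coefficients. -/

namespace FactorialDesign

/-! ### Least squares: unconfounded means orthogonal. -/

section LeastSquares

variable {s p q n : ℕ}

/-- The units of the array. -/
abbrev Cell (s p q : ℕ) : Type := (Fin p → ZMod s) × (Fin q → ZMod s)

/-- The coefficient vector of a linear estimator. -/
noncomputable def estVec (c : LinearEstimator s p q) : EuclideanSpace ℝ (Cell s p q) :=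
  WithLp.toLp 2 fun k => c k.1 k.2

/-- The linear estimator with a given coefficient vector. -/
def vecEst (x : EuclideanSpace ℝ (Cell s p q)) : LinearEstimator s p q := fun i j => x (i, j)

@[simp]
lemma estVec_vecEst (x : EuclideanSpace ℝ (Cell s p q)) : estVec (vecEst x) = x := by
  ext k; simp [estVec, vecEst]

variable [NeZero s]

/-- The vector of expected observations. -/
noncomputable def obsVec (d : RowColumnDesign s p q n) (θ : Parameters s p q n) :
    EuclideanSpace ℝ (Cell s p q) :=
  WithLp.toLp 2 fun k => expectedObs d θ k.1 k.2

lemma expectation_eq_inner (d : RowColumnDesign s p q n) (θ : Parameters s p q n)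
    (c : LinearEstimator s p q) :
    expectation d θ c = inner ℝ (estVec c) (obsVec d θ) := by
  simp [expectation, estVec, obsVec, PiLp.inner_apply, Fintype.sum_prod_type, mul_comm]

lemma cov_eq_inner (σ : ℝ) (c c' : LinearEstimator s p q) :
    cov σ c c' = σ ^ 2 * inner ℝ (estVec c) (estVec c') := by
  simp only [cov, errorCov, estVec, PiLp.inner_apply, mul_ite, mul_zero, Finset.sum_ite_eq,
    Finset.mem_univ, if_true, Finset.mul_sum]
  refine Finset.sum_congr rfl fun k _ => ?_
  simp
  ring

/-- The space of expected observation vectors. -/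
noncomputable def modelSpace (d : RowColumnDesign s p q n) :
    Submodule ℝ (EuclideanSpace ℝ (Cell s p q)) :=
  Submodule.span ℝ (Set.range (obsVec d))

/-- The vector of the contributions of the effect `e` with parameters `t`. -/
noncomputable def effectVec (d : RowColumnDesign s p q n) (e : Effect s n) (t : ZMod s → ℝ) :
    EuclideanSpace ℝ (Cell s p q) :=
  WithLp.toLp 2 fun k => t (Effect.level (d k.1 k.2) e)

/-- The space of contributions of the effect `e`. -/
noncomputable def effectSpace (d : RowColumnDesign s p q n) (e : Effect s n) :
    Submodule ℝ (EuclideanSpace ℝ (Cell s p q)) where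
  carrier := {f | ∃ t : ZMod s → ℝ, ∑ u, t u = 0 ∧ f = effectVec d e t}
  add_mem' := by
    rintro _ _ ⟨t, ht, rfl⟩ ⟨t', ht', rfl⟩
    exact ⟨t + t', by simp [Finset.sum_add_distrib, ht, ht'], by ext k; simp [effectVec]⟩
  zero_mem' := ⟨0, by simp, by ext k; simp [effectVec]⟩
  smul_mem' := by
    rintro a _ ⟨t, ht, rfl⟩
    exact ⟨a • t, by simp [← Finset.mul_sum, ht], by ext k; simp [effectVec]⟩

/-- The parameters all of which vanish except those of the effect `e`. -/
def effectParam (p q : ℕ) (e : Effect s n) (t : ZMod s → ℝ) (ht : ∑ u, t u = 0) :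
    Parameters s p q n where
  mean := 0
  row := 0
  col := 0
  treat := Pi.single e t
  sum_treat e' := by
    by_cases h : e' = e
    · subst h; simpa using ht
    · simp [Pi.single_eq_of_ne h]

lemma obsVec_effectParam (d : RowColumnDesign s p q n) (e : Effect s n) (t : ZMod s → ℝ)
    (ht : ∑ u, t u = 0) : obsVec d (effectParam p q e t ht) = effectVec d e t := by
  ext k
  simp only [obsVec, expectedObs, effectParam, effectVec, Pi.zero_apply, add_zero, zero_add]
  rw [Finset.sum_eq_single e]
  · simp
  · intro e' _ h
    simp [Pi.single_eq_of_ne h]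
  · simp

lemma effectSpace_le (d : RowColumnDesign s p q n) (e : Effect s n) :
    effectSpace d e ≤ modelSpace d := by
  rintro _ ⟨t, ht, rfl⟩
  exact Submodule.subset_span ⟨effectParam p q e t ht, obsVec_effectParam d e t ht⟩

lemma mem_modelSpace_orthogonal {d : RowColumnDesign s p q n}
    {x : EuclideanSpace ℝ (Cell s p q)} :
    x ∈ (modelSpace d)ᗮ ↔ ∀ θ, inner ℝ x (obsVec d θ) = 0 := by
  rw [Submodule.mem_orthogonal']
  constructor
  · intro h θ
    exact h _ (Submodule.subset_span ⟨θ, rfl⟩)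
  · intro h u hu
    induction hu using Submodule.span_induction with
    | mem y hy => obtain ⟨θ, rfl⟩ := hy; exact h θ
    | zero => simp
    | add y z _ _ hy hz => rw [inner_add_right, hy, hz, add_zero]
    | smul a y _ hy => rw [inner_smul_right, hy, mul_zero]

lemma inner_self_add_of_orthogonal {K : Submodule ℝ (EuclideanSpace ℝ (Cell s p q))}
    {y z : EuclideanSpace ℝ (Cell s p q)} (hy : y ∈ K) (hz : z ∈ Kᗮ) :
    inner ℝ (y + z) (y + z) = inner ℝ y y + inner ℝ z z := by
  rw [inner_add_left, inner_add_right, inner_add_right,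
    Submodule.inner_right_of_mem_orthogonal hy hz, Submodule.inner_left_of_mem_orthogonal hy hz]
  ring

/-- A linear unbiased estimator is best exactly if it belongs to the model space. -/
lemma isBLUE_iff {σ : ℝ} (hσ : 0 < σ) {d : RowColumnDesign s p q n} {c : LinearEstimator s p q}
    {ψ : Parameters s p q n → ℝ} :
    IsBLUE σ d c ψ ↔ IsUnbiased d c ψ ∧ estVec c ∈ modelSpace d := by
  have hσ2 : 0 < σ ^ 2 := by positivity
  constructor
  · rintro ⟨hu, hmin⟩
    refine ⟨hu, ?_⟩
    -- Projection to the model space keeps all expectations and removes the variance due to `z`, so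
    -- minimality forces `z = 0`.
    obtain ⟨y, hy, z, hz, hyz⟩ := (modelSpace d).exists_add_mem_mem_orthogonal (estVec c)
    have hun : IsUnbiased d (vecEst y) ψ := by
      intro θ
      have h := hu θ
      rw [expectation_eq_inner] at h ⊢
      rw [hyz, inner_add_left, mem_modelSpace_orthogonal.1 hz θ, add_zero] at h
      simpa using h
    have h := hmin _ hun
    rw [cov_eq_inner, cov_eq_inner, estVec_vecEst, hyz, inner_self_add_of_orthogonal hy hz] at h
    have h0 : inner ℝ z z = 0 := by
      have h1 := le_of_mul_le_mul_left h hσ2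
      have h2 : 0 ≤ inner ℝ z z := real_inner_self_nonneg
      linarith
    rw [hyz, inner_self_eq_zero.1 h0, add_zero]
    exact hy
  · rintro ⟨hu, hmem⟩
    refine ⟨hu, fun c' hu' => ?_⟩
    -- Unbiased estimators of the same function differ by a vector orthogonal to the model space;
    -- Pythagoras then compares the variances.
    have hz : estVec c' - estVec c ∈ (modelSpace d)ᗮ := by
      rw [mem_modelSpace_orthogonal]
      intro θ
      rw [inner_sub_left, ← expectation_eq_inner, ← expectation_eq_inner, hu θ, hu' θ, sub_self]
    rw [cov_eq_inner, cov_eq_inner]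
    refine mul_le_mul_of_nonneg_left ?_ hσ2.le
    have h := inner_self_add_of_orthogonal hmem hz
    rw [add_sub_cancel] at h
    rw [h]
    exact le_add_of_nonneg_right real_inner_self_nonneg

/-- The contributions of the effect `e` are orthogonal to those of all other parameters. -/
def IsOrthogonalEffect (d : RowColumnDesign s p q n) (e : Effect s n) : Prop :=
  ∀ t : ZMod s → ℝ, ∑ u, t u = 0 → ∀ θ : Parameters s p q n, θ.treat e = 0 →
    inner ℝ (effectVec d e t) (obsVec d θ) = 0

/-- The contribution of an unconfounded effect is orthogonal to that of all other parameters. -/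
lemma IsUnconfounded.isOrthogonalEffect {σ : ℝ} (hσ : 0 < σ) {d : RowColumnDesign s p q n}
    {e : Effect s n} (h : IsUnconfounded σ d e) : IsOrthogonalEffect d e := by
  obtain ⟨hex, hunc⟩ := h
  choose c hc using hex
  have hcm : ∀ u, estVec (c u) ∈ modelSpace d := fun u => ((isBLUE_iff hσ).1 (hc u)).2
  have hσ2 : σ ^ 2 ≠ 0 := by positivity
  have hval : ∀ u θ, inner ℝ (estVec (c u)) (obsVec d θ) = θ.treat e u := by
    intro u θ
    rw [← expectation_eq_inner]
    exact (hc u).1 θ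
  -- Such an `x` is the best estimator of its own expectation, a function free of the parameters of
  -- `e`; hence it is uncorrelated with `c u`.
  have horth : ∀ u, ∀ x ∈ modelSpace d, x ∈ (effectSpace d e)ᗮ →
      inner ℝ (estVec (c u)) x = 0 := by
    intro u x hx hx'
    have hdep : DependsOnOthers e fun θ => inner ℝ x (obsVec d θ) := by
      intro θ θ' hm hr hcol ht
      have hsum : ∑ u, (θ.treat e - θ'.treat e) u = 0 := by
        simp [θ.sum_treat, θ'.sum_treat]
      have hdiff : obsVec d θ - obsVec d θ' = effectVec d e (θ.treat e - θ'.treat e) := by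
        ext k
        simp only [obsVec, expectedObs, effectVec, PiLp.sub_apply, hm, hr, hcol, Pi.sub_apply,
          add_sub_add_left_eq_sub, ← Finset.sum_sub_distrib]
        rw [Finset.sum_eq_single e]
        · intro e' _ he'
          simp [ht e' he']
        · simp
      have h0 := (Submodule.mem_orthogonal' _ _).1 hx' _ ⟨_, hsum, hdiff⟩
      rw [inner_sub_right] at h0
      simpa [sub_eq_zero] using h0
    have hb : IsBLUE σ d (vecEst x) fun θ => inner ℝ x (obsVec d θ) := by
      rw [isBLUE_iff hσ]
      refine ⟨fun θ => ?_, by simpa using hx⟩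
      rw [expectation_eq_inner, estVec_vecEst]
    have h0 := hunc u (c u) (hc u) _ _ hdep hb
    rw [cov_eq_inner, estVec_vecEst] at h0
    exact (mul_eq_zero.1 h0).resolve_left hσ2
  have hce : ∀ u, estVec (c u) ∈ effectSpace d e := by
    intro u
    obtain ⟨y, hy, z, hz, hyz⟩ := (effectSpace d e).exists_add_mem_mem_orthogonal (estVec (c u))
    have hzm : z ∈ modelSpace d := by
      have : z = estVec (c u) - y := by rw [hyz]; abel
      rw [this]
      exact Submodule.sub_mem _ (hcm u) (effectSpace_le d e hy)
    have h0 := horth u z hzm hz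
    rw [hyz, inner_add_left, Submodule.inner_right_of_mem_orthogonal hy hz, zero_add,
      inner_self_eq_zero] at h0
    rw [hyz, h0, add_zero]
    exact hy
  -- `D` turns out to be all of `effectSpace d e`: a contribution orthogonal to `D` has parameters
  -- that are all estimated as zero.
  set D : Submodule ℝ (EuclideanSpace ℝ (Cell s p q)) :=
    Submodule.span ℝ (Set.range fun u => estVec (c u)) with hD
  have hDle : D ≤ effectSpace d e := by
    rw [hD, Submodule.span_le]
    rintro _ ⟨u, rfl⟩
    exact hce u
  intro t ht θ hθ
  obtain ⟨y, hy, z, hz, hyz⟩ := D.exists_add_mem_mem_orthogonal (effectVec d e t)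
  have hze : z ∈ effectSpace d e := by
    have : z = effectVec d e t - y := by rw [hyz]; abel
    rw [this]
    exact Submodule.sub_mem _ ⟨t, ht, rfl⟩ (hDle hy)
  obtain ⟨t', ht', rfl⟩ := hze
  have ht0 : t' = 0 := by
    funext u
    have h1 := hval u (effectParam p q e t' ht')
    rw [obsVec_effectParam, (Submodule.mem_orthogonal _ _).1 hz _
      (Submodule.subset_span ⟨u, rfl⟩)] at h1
    simpa [effectParam] using h1.symm
  have hz0 : effectVec d e t' = 0 := by
    ext k; simp [effectVec, ht0]
  rw [hyz, hz0, add_zero]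
  have hort : obsVec d θ ∈ Dᗮ := by
    rw [hD, Submodule.mem_orthogonal]
    intro x hx
    induction hx using Submodule.span_induction with
    | mem x hx => obtain ⟨u, rfl⟩ := hx; simp [hval, hθ]
    | zero => simp
    | add x x' _ _ hx hx' => rw [inner_add_left, hx, hx', add_zero]
    | smul a x _ hx => rw [inner_smul_left, hx, mul_zero]
  exact Submodule.inner_right_of_mem_orthogonal hy hort

/-- An effect orthogonal to the overall mean occurs with all levels equally often. -/
lemma IsOrthogonalEffect.exists_replication {d : RowColumnDesign s p q n} {e : Effect s n}
    (h : IsOrthogonalEffect d e) :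
    ∃ m : ℝ, 0 < m ∧ ∀ f : ZMod s → ℝ,
      ∑ k : Cell s p q, f (Effect.level (d k.1 k.2) e) = m * ∑ u, f u := by
  classical
  let N : ZMod s → ℝ := fun u =>
    ∑ k : Cell s p q, if Effect.level (d k.1 k.2) e = u then (1 : ℝ) else 0
  -- The contrast of level `u` against level `0` is orthogonal to the overall mean, which equates
  -- their frequencies.
  have hN : ∀ u, N u = N 0 := by
    intro u
    have h0 := h (Pi.single u 1 - Pi.single 0 1) (by simp)
      ⟨1, 0, 0, 0, fun e => by simp⟩ rfl
    simp only [effectVec, obsVec, expectedObs, PiLp.inner_apply, Pi.zero_apply,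
      Finset.sum_const_zero, add_zero, Pi.sub_apply, Pi.single_apply] at h0
    simp only [RCLike.inner_apply, conj_trivial, one_mul, Finset.sum_sub_distrib, sub_eq_zero] at h0
    exact h0
  have hsum : ∀ f : ZMod s → ℝ,
      ∑ k : Cell s p q, f (Effect.level (d k.1 k.2) e) = N 0 * ∑ u, f u := by
    intro f
    have : ∀ k : Cell s p q, f (Effect.level (d k.1 k.2) e) =
        ∑ u, (if Effect.level (d k.1 k.2) e = u then (1 : ℝ) else 0) * f u := by
      intro k; simp
    simp only [this]
    rw [Finset.sum_comm, Finset.mul_sum]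
    refine Finset.sum_congr rfl fun u _ => ?_
    rw [← Finset.sum_mul, ← hN u]
  refine ⟨N 0, ?_, hsum⟩
  have h1 := hsum 1
  simp only [Pi.one_apply, Finset.sum_const, nsmul_eq_mul, mul_one] at h1
  have h2 : (0 : ℝ) < (Finset.univ : Finset (Cell s p q)).card := by
    exact_mod_cast Finset.card_pos.2 ⟨(0, 0), Finset.mem_univ _⟩
  have h3 : (0 : ℝ) < (Finset.univ : Finset (ZMod s)).card := by
    exact_mod_cast Finset.card_pos.2 ⟨0, Finset.mem_univ _⟩
  rw [h1] at h2
  exact pos_of_mul_pos_left h2 h3.le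

/-- An effect orthogonal to all others is unconfounded. -/
lemma IsOrthogonalEffect.isUnconfounded {σ : ℝ} (hσ : 0 < σ) {d : RowColumnDesign s p q n}
    {e : Effect s n} (h : IsOrthogonalEffect d e) : IsUnconfounded σ d e := by
  classical
  obtain ⟨m, hm, hrep⟩ := h.exists_replication
  have hs : (s : ℝ) ≠ 0 := by exact_mod_cast NeZero.ne s
  have hsplit : ∀ θ : Parameters s p q n, ∃ θ' : Parameters s p q n, θ'.treat e = 0 ∧
      obsVec d θ = effectVec d e (θ.treat e) + obsVec d θ' := by
    intro θ
    refine ⟨⟨θ.mean, θ.row, θ.col, Function.update θ.treat e 0, fun e' => ?_⟩, ?_, ?_⟩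
    · by_cases he : e' = e
      · subst he; simp
      · simp [Function.update_of_ne he, θ.sum_treat]
    · simp
    · ext k
      simp only [obsVec, expectedObs, effectVec, PiLp.add_apply]
      rw [← Finset.add_sum_erase _ _ (Finset.mem_univ e),
        ← Finset.add_sum_erase (a := e) _ (fun e' => Function.update θ.treat e 0 e' _)
          (Finset.mem_univ e)]
      have : ∑ x ∈ Finset.univ.erase e, Function.update θ.treat e 0 x (Effect.level (d k.1 k.2) x)
          = ∑ x ∈ Finset.univ.erase e, θ.treat x (Effect.level (d k.1 k.2) x) :=
        Finset.sum_congr rfl fun x hx => by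
          rw [Function.update_of_ne (Finset.ne_of_mem_erase hx)]
      rw [this]
      simp
      ring
  -- The mean over the `m` units at level `u`, minus the overall mean; subtracting `s⁻¹` makes it a
  -- contrast.
  let t : ZMod s → ZMod s → ℝ := fun u w => m⁻¹ * ((if w = u then 1 else 0) - (s : ℝ)⁻¹)
  have ht : ∀ u, ∑ w, t u w = 0 := by
    intro u
    simp [t, ← Finset.mul_sum, Finset.sum_sub_distrib, ZMod.card, hs]
  have hc : ∀ u (θ : Parameters s p q n),
      inner ℝ (effectVec d e (t u)) (obsVec d θ) = θ.treat e u := by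
    intro u θ
    obtain ⟨θ', hθ', hobs⟩ := hsplit θ
    rw [hobs, inner_add_right, h _ (ht u) _ hθ', add_zero]
    simp only [effectVec, PiLp.inner_apply, RCLike.inner_apply, conj_trivial]
    rw [hrep fun w => θ.treat e w * t u w]
    have : ∀ w, θ.treat e w * t u w =
        m⁻¹ * ((if w = u then θ.treat e w else 0) - (s : ℝ)⁻¹ * θ.treat e w) := by
      intro w
      by_cases hw : w = u <;> simp [t, hw] <;> ring
    simp only [this]
    rw [← Finset.mul_sum, Finset.sum_sub_distrib, ← Finset.mul_sum, θ.sum_treat]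
    simp [hm.ne']
  have hmem : ∀ u, effectVec d e (t u) ∈ modelSpace d := fun u =>
    effectSpace_le d e ⟨_, ht u, rfl⟩
  refine ⟨fun u => ⟨vecEst (effectVec d e (t u)), ?_⟩, ?_⟩
  · rw [isBLUE_iff hσ]
    refine ⟨fun θ => ?_, by simpa using hmem u⟩
    rw [expectation_eq_inner, estVec_vecEst, hc]
  · intro u c hcB ψ c' hdep hB
    obtain ⟨hcu, hcm⟩ := (isBLUE_iff hσ).1 hcB
    obtain ⟨hcu', -⟩ := (isBLUE_iff hσ).1 hB
    have hceq : estVec c = effectVec d e (t u) := by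
      have h1 : estVec c - effectVec d e (t u) ∈ (modelSpace d)ᗮ := by
        rw [mem_modelSpace_orthogonal]
        intro θ
        rw [inner_sub_left, ← expectation_eq_inner, hcu θ, hc, sub_self]
      have h2 : inner ℝ (estVec c - effectVec d e (t u)) (estVec c - effectVec d e (t u)) = 0 :=
        Submodule.inner_left_of_mem_orthogonal (Submodule.sub_mem _ hcm (hmem u)) h1
      exact sub_eq_zero.1 (inner_self_eq_zero.1 h2)
    -- `ψ` cannot tell these parameters apart, so its estimator `c'` is orthogonal to the vector of
    -- `c`.
    have h0 := hdep (effectParam p q e (t u) (ht u)) (effectParam p q e 0 (by simp)) rfl rfl rfl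
      fun e' he' => by simp [effectParam, Pi.single_eq_of_ne he']
    rw [← hcu', ← hcu', expectation_eq_inner, expectation_eq_inner, obsVec_effectParam,
      obsVec_effectParam] at h0
    have hz : effectVec d e (0 : ZMod s → ℝ) = 0 := by ext k; simp [effectVec]
    rw [hz, inner_zero_right] at h0
    rw [cov_eq_inner, hceq, real_inner_comm, h0, mul_zero]

lemma isUnconfounded_iff {σ : ℝ} (hσ : 0 < σ) {d : RowColumnDesign s p q n} {e : Effect s n} :
    IsUnconfounded σ d e ↔ IsOrthogonalEffect d e :=
  ⟨fun h => h.isOrthogonalEffect hσ, fun h => h.isUnconfounded hσ⟩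

end LeastSquares

/-! ### Orthogonality to rows, columns and other effects. -/

section Orthogonality

variable {s p q n : ℕ} [NeZero s]

lemma inner_effectVec (d : RowColumnDesign s p q n) (e : Effect s n) (t : ZMod s → ℝ)
    (x : EuclideanSpace ℝ (Cell s p q)) :
    inner ℝ (effectVec d e t) x = ∑ k : Cell s p q, t (Effect.level (d k.1 k.2) e) * x k := by
  simp [effectVec, PiLp.inner_apply, mul_comm]

/-- An effect is orthogonal to the other parameters exactly if it is orthogonal to the row effects,
the column effects and the other treatment effects. -/
lemma isOrthogonalEffect_iff {d : RowColumnDesign s p q n} {e : Effect s n} :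
    IsOrthogonalEffect d e ↔ ∀ t : ZMod s → ℝ, ∑ u, t u = 0 →
      (∀ i, ∑ j, t (Effect.level (d i j) e) = 0) ∧ (∀ j, ∑ i, t (Effect.level (d i j) e) = 0) ∧
      ∀ e', e' ≠ e → ∀ t' : ZMod s → ℝ, ∑ u, t' u = 0 → ∑ k : Cell s p q,
        t (Effect.level (d k.1 k.2) e) * t' (Effect.level (d k.1 k.2) e') = 0 := by
  classical
  constructor
  · intro h t ht
    refine ⟨fun i => ?_, fun j => ?_, fun e' he t' ht' => ?_⟩
    · have h0 := h t ht ⟨0, Pi.single i 1, 0, 0, fun e => by simp⟩ rfl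
      simpa [inner_effectVec, obsVec, expectedObs, Fintype.sum_prod_type, Pi.single_apply,
        ← Finset.sum_mul] using h0
    · have h0 := h t ht ⟨0, 0, Pi.single j 1, 0, fun e => by simp⟩ rfl
      simpa [inner_effectVec, obsVec, expectedObs, Fintype.sum_prod_type, Pi.single_apply] using h0
    · have h0 := h t ht (effectParam p q e' t' ht') (by simp [effectParam, he.symm])
      rw [obsVec_effectParam, inner_effectVec] at h0
      exact h0
  · intro h t ht θ hθ
    obtain ⟨hrow, hcol, heff⟩ := h t ht
    rw [inner_effectVec]
    simp only [obsVec, expectedObs, mul_add, Finset.sum_add_distrib, Fintype.sum_prod_type]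
    have h1 : ∑ i, ∑ j, t (Effect.level (d i j) e) * θ.mean = 0 := by
      simp [← Finset.sum_mul, hrow]
    have h2 : ∑ i, ∑ j, t (Effect.level (d i j) e) * θ.row i = 0 := by
      simp [← Finset.sum_mul, hrow]
    have h3 : ∑ i, ∑ j, t (Effect.level (d i j) e) * θ.col j = 0 := by
      rw [Finset.sum_comm]
      simp [← Finset.sum_mul, hcol]
    have h4 : ∑ i, ∑ j, t (Effect.level (d i j) e) *
        ∑ e' : Effect s n, θ.treat e' (Effect.level (d i j) e') = 0 := by
      simp only [Finset.mul_sum]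
      have : ∀ i, ∑ j, ∑ e' : Effect s n, t (Effect.level (d i j) e) *
          θ.treat e' (Effect.level (d i j) e') = ∑ e' : Effect s n, ∑ j,
          t (Effect.level (d i j) e) * θ.treat e' (Effect.level (d i j) e') :=
        fun i => Finset.sum_comm
      simp only [this]
      rw [Finset.sum_comm]
      refine Finset.sum_eq_zero fun e' _ => ?_
      by_cases he : e' = e
      · subst he; simp [hθ]
      · have := heff e' he (θ.treat e') (θ.sum_treat e')
        rwa [Fintype.sum_prod_type] at this
    rw [h1, h2, h3, h4]
    simp

end Orthogonality

/-! ### Contrasts of pairs of levels and the graph of unconfounded interactions. -/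

section PairIndicator

variable {s p q n : ℕ}

/-- The indicator of the pair of levels `(a, b)`, scaled and shifted to have sum zero. -/
noncomputable def pairContrast (a b x y : ZMod s) : ℝ :=
  s * (if x = a ∧ y = b then 1 else 0) - (s : ℝ)⁻¹

lemma pairContrast_swap (a b x y : ZMod s) : pairContrast a b x y = pairContrast b a y x := by
  simp only [pairContrast, and_comm]

variable [Fact s.Prime]

/-- The indicator of the level `a`, shifted to have sum zero. -/
noncomputable def levelContrast (a x : ZMod s) : ℝ := (if x = a then 1 else 0) - (s : ℝ)⁻¹

lemma sum_levelContrast (a : ZMod s) : ∑ u, levelContrast a u = 0 := by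
  have hs : (s : ℝ) ≠ 0 := by exact_mod_cast NeZero.ne s
  simp [levelContrast, Finset.sum_sub_distrib, ZMod.card, hs]

/-- The contrast of a pair of levels is a sum of contrasts of the two main effects and of the
components of the interaction. -/
lemma pairContrast_eq (a b x y : ZMod s) :
    pairContrast a b x y = levelContrast a x + levelContrast b y +
      ∑ v ∈ Finset.univ.erase (0 : ZMod s), levelContrast (a + v * b) (x + v * y) := by
  have hs : (s : ℝ) ≠ 0 := by exact_mod_cast NeZero.ne s
  have hs1 : 1 ≤ s := (Fact.out : s.Prime).one_lt.le
  -- The number of components whose level agrees with that of `(a, b)`: all `s - 1` if both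
  -- coordinates agree, none if exactly one does, and otherwise one, at `v = (a - x) / (y - b)`.
  have key : ∑ v ∈ Finset.univ.erase (0 : ZMod s),
      (if x + v * y = a + v * b then (1 : ℝ) else 0) =
      if y = b then (if x = a then (s : ℝ) - 1 else 0) else (if x = a then 0 else 1) := by
    by_cases hy : y = b
    · subst hy
      by_cases hx : x = a
      · subst hx; simp [ZMod.card, Nat.cast_sub hs1]
      · simp [hx]
    · have hyb : y - b ≠ 0 := sub_ne_zero.2 hy
      by_cases hx : x = a
      · subst hx
        simp only [hy, if_false, if_true]
        refine Finset.sum_eq_zero fun v hv => ?_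
        have hv0 := Finset.ne_of_mem_erase hv
        rw [if_neg]
        intro h
        exact hy (mul_left_cancel₀ hv0 (add_left_cancel h))
      · simp only [hy, hx, if_false]
        rw [Finset.sum_eq_single_of_mem ((a - x) / (y - b))]
        · rw [if_pos]
          field_simp
          ring
        · simp [sub_eq_zero, hy, Ne.symm hx]
        · intro v _ hv
          rw [if_neg]
          intro h
          apply hv
          rw [eq_div_iff hyb]
          linear_combination h
  simp only [levelContrast, Finset.sum_sub_distrib, key, pairContrast]
  have hcard : ((Finset.univ.erase (0 : ZMod s)).card : ℝ) = s - 1 := by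
    simp [ZMod.card, Nat.cast_sub hs1]
  rw [Finset.sum_const, nsmul_eq_mul, hcard]
  by_cases hx : x = a <;> by_cases hy : y = b <;> simp [hx, hy] <;> field_simp <;> ring

/-- A function orthogonal to the effects of two factors and to all components of their interaction is
orthogonal to the contrasts of pairs of levels. -/
lemma sum_pairContrast_mul_eq_zero {κ : Type*} [Fintype κ] (x : κ → Fin n → ZMod s) {l m : Fin n}
    (hlm : l < m) (h : κ → ℝ)
    (hl : ∀ t : ZMod s → ℝ, ∑ u, t u = 0 → ∑ k, t (Effect.level (x k) (mainEffect s l)) * h k = 0)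
    (hm : ∀ t : ZMod s → ℝ, ∑ u, t u = 0 → ∑ k, t (Effect.level (x k) (mainEffect s m)) * h k = 0)
    (hc : ∀ v (hv : v ≠ 0), ∀ t : ZMod s → ℝ, ∑ u, t u = 0 →
      ∑ k, t (Effect.level (x k) (component l m v hlm hv)) * h k = 0) (a b : ZMod s) :
    ∑ k, pairContrast a b (x k l) (x k m) * h k = 0 := by
  simp only [pairContrast_eq, add_mul, Finset.sum_add_distrib, Finset.sum_mul]
  have h1 : ∑ k, levelContrast a (x k l) * h k = 0 := hl _ (sum_levelContrast a)
  have h2 : ∑ k, levelContrast b (x k m) * h k = 0 := hm _ (sum_levelContrast b)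
  rw [h1, h2, Finset.sum_comm, add_zero, zero_add]
  exact Finset.sum_eq_zero fun v hv =>
    hc v (Finset.ne_of_mem_erase hv) _ (sum_levelContrast (a + v * b))

/-- The graph on the factors whose edges are the unconfounded two-factor interactions. -/
def unconfoundedGraph (σ : ℝ) (d : RowColumnDesign s p q n) : SimpleGraph (Fin n) where
  Adj l m := (∃ h : l < m, InteractionUnconfounded σ d l m h) ∨
    ∃ h : m < l, InteractionUnconfounded σ d m l h
  symm := ⟨fun _ _ h => h.symm⟩
  loopless := ⟨fun _ h => by rcases h with ⟨h, -⟩ | ⟨h, -⟩ <;> exact lt_irrefl _ h⟩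

variable {σ : ℝ} {d : RowColumnDesign s p q n}

/-- The pair contrast is a sum of contrasts of two main effects and `s - 1` components, all
unconfounded and so of sum zero in each row. With `card_pair_of_sum_pairContrast` all pairs of
levels are equally frequent in a row. -/
lemma sum_pairContrast_row (hσ : 0 < σ) (hmain : MainEffectsUnconfounded σ d) {l m : Fin n}
    (hlm : (unconfoundedGraph σ d).Adj l m) (a b : ZMod s) (i : Fin p → ZMod s) :
    ∑ j, pairContrast a b (d i j l) (d i j m) = 0 := by
  have hrow : ∀ e, IsUnconfounded σ d e → ∀ t : ZMod s → ℝ, ∑ u, t u = 0 →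
      ∑ j, t (Effect.level (d i j) e) * 1 = 0 := fun e he t ht => by
    simpa using (isOrthogonalEffect_iff.1 (he.isOrthogonalEffect hσ) t ht).1 i
  rcases hlm with ⟨h, hI⟩ | ⟨h, hI⟩
  · simpa using sum_pairContrast_mul_eq_zero (fun j => d i j) h (fun _ => 1)
      (hrow _ (hmain l)) (hrow _ (hmain m)) (fun v hv => hrow _ (hI v hv)) a b
  · simpa [pairContrast_swap a b] using sum_pairContrast_mul_eq_zero (fun j => d i j) h (fun _ => 1)
      (hrow _ (hmain m)) (hrow _ (hmain l)) (fun v hv => hrow _ (hI v hv)) b a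

lemma sum_pairContrast_col (hσ : 0 < σ) (hmain : MainEffectsUnconfounded σ d) {l m : Fin n}
    (hlm : (unconfoundedGraph σ d).Adj l m) (a b : ZMod s) (j : Fin q → ZMod s) :
    ∑ i, pairContrast a b (d i j l) (d i j m) = 0 := by
  have hcol : ∀ e, IsUnconfounded σ d e → ∀ t : ZMod s → ℝ, ∑ u, t u = 0 →
      ∑ i, t (Effect.level (d i j) e) * 1 = 0 := fun e he t ht => by
    simpa using (isOrthogonalEffect_iff.1 (he.isOrthogonalEffect hσ) t ht).2.1 j
  rcases hlm with ⟨h, hI⟩ | ⟨h, hI⟩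
  · simpa using sum_pairContrast_mul_eq_zero (fun i => d i j) h (fun _ => 1)
      (hcol _ (hmain l)) (hcol _ (hmain m)) (fun v hv => hcol _ (hI v hv)) a b
  · simpa [pairContrast_swap a b] using sum_pairContrast_mul_eq_zero (fun i => d i j) h (fun _ => 1)
      (hcol _ (hmain m)) (hcol _ (hmain l)) (fun v hv => hcol _ (hI v hv)) b a

/-- A pair contrast of total zero determines the frequency of the pair of levels. -/
lemma card_pair_of_sum_pairContrast {κ : Type*} [Fintype κ] {x y : κ → ZMod s} {a b : ZMod s}
    (h : ∑ k, pairContrast a b (x k) (y k) = 0) :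
    s ^ 2 * (Finset.univ.filter fun k => x k = a ∧ y k = b).card = Fintype.card κ := by
  have hs : (s : ℝ) ≠ 0 := by exact_mod_cast NeZero.ne s
  simp only [pairContrast, Finset.sum_sub_distrib, ← Finset.mul_sum, Finset.sum_boole,
    Finset.sum_const, Finset.card_univ, nsmul_eq_mul, sub_eq_zero] at h
  have h2 : (s : ℝ) ^ 2 * (Finset.univ.filter fun k => x k = a ∧ y k = b).card =
      Fintype.card κ := by
    rw [pow_two, mul_assoc, h]
    field_simp
  exact_mod_cast h2

/-- Contrasts of two disjoint pairs of factors, the first of which is unconfounded, are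
orthogonal. -/
lemma sum_pairContrast_mul_pairContrast (hσ : 0 < σ) (hmain : MainEffectsUnconfounded σ d)
    {l m i j : Fin n} (hlm : (unconfoundedGraph σ d).Adj l m) (hij : i ≠ j) (hli : l ≠ i)
    (hlj : l ≠ j) (hmi : m ≠ i) (hmj : m ≠ j) (a b a' b' : ZMod s) :
    ∑ k : Cell s p q, pairContrast a b (d k.1 k.2 l) (d k.1 k.2 m) *
      pairContrast a' b' (d k.1 k.2 i) (d k.1 k.2 j) = 0 := by
  wlog hlt : l < m generalizing l m a b
  · have := this hlm.symm hmi hmj hli hlj b a (lt_of_le_of_ne (not_lt.1 hlt) hlm.ne.symm)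
    simpa only [pairContrast_swap a b] using this
  wlog hlt' : i < j generalizing i j a' b'
  · have := this hij.symm b' a' hlj hli hmj hmi (lt_of_le_of_ne (not_lt.1 hlt') hij.symm)
    simpa only [pairContrast_swap a' b'] using this
  have hI : InteractionUnconfounded σ d l m hlt := by
    rcases hlm with ⟨_, hI⟩ | ⟨h, -⟩
    · exact hI
    · exact absurd h hlt.asymm
  -- An unconfounded effect is orthogonal to every other effect, confounded or not. So only the pair
  -- `l`, `m` needs an unconfounded interaction, and disjointness of the pairs keeps their effects
  -- different.
  have hee : ∀ e e', IsUnconfounded σ d e → e' ≠ e → ∀ t t' : ZMod s → ℝ, ∑ u, t u = 0 →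
      ∑ u, t' u = 0 → ∑ k : Cell s p q, t' (Effect.level (d k.1 k.2) e') *
        t (Effect.level (d k.1 k.2) e) = 0 := fun e e' he hne t t' ht ht' => by
    simpa only [mul_comm] using
      (isOrthogonalEffect_iff.1 (he.isOrthogonalEffect hσ) t ht).2.2 e' hne t' ht'
  have hone : ∀ e, IsUnconfounded σ d e → mainEffect s i ≠ e → mainEffect s j ≠ e →
      (∀ v (hv : v ≠ 0), component i j v hlt' hv ≠ e) → ∀ t : ZMod s → ℝ, ∑ u, t u = 0 →
      ∑ k : Cell s p q, t (Effect.level (d k.1 k.2) e) *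
        pairContrast a' b' (d k.1 k.2 i) (d k.1 k.2 j) = 0 := by
    intro e he h1 h2 h3 t ht
    have := sum_pairContrast_mul_eq_zero (fun k : Cell s p q => d k.1 k.2) hlt'
      (fun k => t (Effect.level (d k.1 k.2) e)) (fun t' ht' => hee e _ he h1 t t' ht ht')
      (fun t' ht' => hee e _ he h2 t t' ht ht')
      (fun v hv t' ht' => hee e _ he (h3 v hv) t t' ht ht') a' b'
    simpa only [mul_comm] using this
  refine sum_pairContrast_mul_eq_zero (fun k : Cell s p q => d k.1 k.2) hlt _
    (hone _ (hmain l) ?_ ?_ ?_) (hone _ (hmain m) ?_ ?_ ?_)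
    (fun v hv => hone _ (hI v hv) ?_ ?_ ?_) a b <;>
    simp [mainEffect, component, hli.symm, hlj.symm, hmi.symm, hmj.symm]

end PairIndicator

/-! ### The number `phi` as a Turán number. -/

section Phi

variable {s q n : ℕ}

/-- The number `phi` for arrays with `s ^ 2` rows. -/
lemma phi_two (hs : 2 ≤ s) (hq : 2 ≤ q) :
    phi s 2 q n = (n.choose 2 : ℤ) - (s + 1 : ℕ) * ((n / (s + 1)).choose 2 : ℤ) -
      (n / (s + 1) : ℕ) * (n % (s + 1) : ℕ) := by
  have hN : (s ^ min 2 q - 1) / (s - 1) = s + 1 := by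
    rw [min_eq_left hq]
    obtain ⟨r, rfl⟩ : ∃ r, s = r + 2 := ⟨s - 2, by omega⟩
    refine Nat.div_eq_of_eq_mul_left (by omega) ?_
    have : (r + 2) ^ 2 = (r + 2 + 1) * (r + 1) + 1 := by ring
    rw [this]
    simp
  have hmod : n - (s + 1) * (n / (s + 1)) = n % (s + 1) := by
    have := Nat.div_add_mod n (s + 1)
    omega
  simp only [phi, hN, hmod]

lemma int_choose_two (m : ℕ) : 2 * (m.choose 2 : ℤ) = m * (m - 1) := by
  induction m with
  | zero => simp
  | succ k ih =>
    rw [Nat.choose_succ_succ, Nat.choose_one_right]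
    push_cast
    linarith

/-- Twice the number `phi`. -/
lemma two_mul_phi (hs : 2 ≤ s) (hq : 2 ≤ q) :
    2 * phi s 2 q n = (n : ℤ) * (n - 1) -
      (s + 1) * ((n / (s + 1) : ℕ) * ((n / (s + 1) : ℕ) - 1)) -
      2 * ((n / (s + 1) : ℕ) * (n % (s + 1) : ℕ)) := by
  rw [phi_two hs hq]
  have h1 := int_choose_two n
  have h2 := int_choose_two (n / (s + 1))
  push_cast at h2 ⊢
  linear_combination h1 - (s + 1 : ℤ) * h2

end Phi

/-! ### Turán's bound for unconfounded interactions. -/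

section UpperBound

variable {s p q n : ℕ} [Fact s.Prime] {σ : ℝ}

lemma numUnconfounded_eq_card_edgeFinset (σ : ℝ) (d : RowColumnDesign s p q n)
    [DecidableRel (unconfoundedGraph σ d).Adj] :
    numUnconfounded σ d = (unconfoundedGraph σ d).edgeFinset.card := by
  rw [← Set.ncard_coe_finset, SimpleGraph.coe_edgeFinset, numUnconfounded]
  refine Set.ncard_congr (fun t _ => s(t.1, t.2)) ?_ ?_ ?_
  · rintro ⟨l, m⟩ h
    exact Or.inl h
  · rintro ⟨l, m⟩ ⟨l', m'⟩ ⟨h, -⟩ ⟨h', -⟩ heq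
    rcases Sym2.eq_iff.1 heq with ⟨h1, h2⟩ | ⟨h1, h2⟩
    · exact Prod.ext h1 h2
    · simp only at h h' h1 h2
      subst h1 h2
      exact absurd h h'.asymm
  · intro e
    induction e using Sym2.ind with
    | _ l m =>
      rintro (h | h)
      · exact ⟨(l, m), h, rfl⟩
      · exact ⟨(m, l), h, Sym2.eq_swap⟩

/-- In every column of an array with `s ^ 2` rows, each level of a factor with unconfounded main
effect occurs `s` times. -/
lemma card_level_col (hσ : 0 < σ) {d : RowColumnDesign s 2 q n} {l : Fin n}
    (hl : IsUnconfounded σ d (mainEffect s l)) (a : ZMod s) (j : Fin q → ZMod s) :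
    (Finset.univ.filter fun i => d i j l = a).card = s := by
  have hs : (s : ℝ) ≠ 0 := by exact_mod_cast NeZero.ne s
  have h : ∑ i, levelContrast a (d i j l) = 0 :=
    (isOrthogonalEffect_iff.1 (hl.isOrthogonalEffect hσ) _ (sum_levelContrast a)).2.1 j
  simp only [levelContrast, Finset.sum_sub_distrib, Finset.sum_boole, Finset.sum_const,
    Finset.card_univ, nsmul_eq_mul, sub_eq_zero, Fintype.card_fun, ZMod.card, Fintype.card_fin] at h
  push_cast at h
  field_simp at h
  exact_mod_cast h

/-- In every column of an array with `s ^ 2` rows, each pair of levels of two factors with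
unconfounded interaction occurs once. -/
lemma card_pair_col (hσ : 0 < σ) {d : RowColumnDesign s 2 q n}
    (hmain : MainEffectsUnconfounded σ d) {l m : Fin n}
    (hlm : (unconfoundedGraph σ d).Adj l m) (a b : ZMod s) (j : Fin q → ZMod s) :
    (Finset.univ.filter fun i => d i j l = a ∧ d i j m = b).card = 1 := by
  have h := card_pair_of_sum_pairContrast (sum_pairContrast_col hσ hmain hlm a b j)
  simp only [Fintype.card_fun, ZMod.card, Fintype.card_fin] at h
  exact Nat.eq_of_mul_eq_mul_left (pow_pos (NeZero.pos s) 2) (by rw [h, mul_one])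

/-- The graph of unconfounded interactions has no clique on `s + 2` factors. -/
lemma cliqueFree_unconfoundedGraph (hσ : 0 < σ) {d : RowColumnDesign s 2 q n}
    (hmain : MainEffectsUnconfounded σ d) : (unconfoundedGraph σ d).CliqueFree (s + 1 + 1) := by
  classical
  intro T hT
  -- The cells of one column that agree in factor `l` with its cell in row `0`, apart from that
  -- cell. Adjacent factors have disjoint sets, because a pair of levels occurs only once.
  let A : Fin n → Finset (Fin 2 → ZMod s) := fun l =>
    (Finset.univ.filter fun i => d i 0 l = d 0 0 l).erase 0
  have hA : ∀ l, (A l).card = s - 1 := by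
    intro l
    rw [Finset.card_erase_of_mem (by simp), card_level_col hσ (hmain l)]
  have hdisj : (T : Set (Fin n)).PairwiseDisjoint A := by
    intro l hl m hm hlm
    rw [Function.onFun, Finset.disjoint_left]
    intro i hi hi'
    simp only [A, Finset.mem_erase, Finset.mem_filter, Finset.mem_univ, true_and] at hi hi'
    have hc := card_pair_col hσ hmain (hT.isClique hl hm hlm) (d 0 0 l) (d 0 0 m) 0
    exact hi.1 (Finset.card_le_one.1 hc.le i (by simp [hi.2, hi'.2]) 0 (by simp))
  have hsub : T.biUnion A ⊆ Finset.univ.erase 0 := by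
    intro i hi
    simp only [Finset.mem_biUnion, A, Finset.mem_erase] at hi ⊢
    obtain ⟨l, -, h, -⟩ := hi
    exact ⟨h, Finset.mem_univ _⟩
  -- This reads `(s + 2) * (s - 1) ≤ s ^ 2 - 1`, which is false for `s ≥ 2`.
  have hle := Finset.card_le_card hsub
  rw [Finset.card_biUnion hdisj, Finset.sum_congr rfl fun l _ => hA l, Finset.sum_const,
    hT.card_eq, Finset.card_erase_of_mem (Finset.mem_univ _), Finset.card_univ, Fintype.card_fun,
    ZMod.card, Fintype.card_fin, smul_eq_mul] at hle
  obtain ⟨r, hr⟩ : ∃ r, s = r + 2 := ⟨s - 2, by have := (Fact.out : s.Prime).two_le; omega⟩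
  have hpos : 1 ≤ s ^ 2 := Nat.one_le_pow _ _ (NeZero.pos s)
  rw [hr] at hle hpos
  zify [hpos] at hle
  rw [show r + 2 - 1 = r + 1 by omega] at hle
  push_cast at hle
  nlinarith

/-- Turán's bound for the number of unconfounded interactions. -/
lemma numUnconfounded_le_phi (hσ : 0 < σ) (hq : 2 ≤ q) {d : RowColumnDesign s 2 q n}
    (hmain : MainEffectsUnconfounded σ d) : (numUnconfounded σ d : ℤ) ≤ phi s 2 q n := by
  classical
  have hs2 : 2 ≤ s := (Fact.out : s.Prime).two_le
  rw [numUnconfounded_eq_card_edgeFinset]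
  have h := (cliqueFree_unconfoundedGraph hσ hmain).card_edgeFinset_le
  simp only [Fintype.card_fin, Nat.add_sub_cancel] at h
  have h2 := int_choose_two (n % (s + 1))
  have hphi := two_mul_phi (n := n) hs2 hq
  have hdm := Nat.div_add_mod n (s + 1)
  set α := n / (s + 1)
  set β := n % (s + 1)
  have hsq : n ^ 2 - β ^ 2 = (s + 1) * α * ((s + 1) * α + 2 * β) := by
    rw [← hdm]
    refine Nat.sub_eq_of_eq_add ?_
    ring
  -- Only this inequality for the rounded quotient in Turán's bound is needed, since its right side
  -- is the matching part of `2 * phi`.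
  have hdiv : 2 * ((n ^ 2 - β ^ 2) * s / (2 * (s + 1))) ≤ α * ((s + 1) * α + 2 * β) * s := by
    rw [hsq, show (s + 1) * α * ((s + 1) * α + 2 * β) * s =
      (s + 1) * (α * ((s + 1) * α + 2 * β) * s) by ring, mul_comm 2 (s + 1),
      Nat.mul_div_mul_left _ _ (Nat.succ_pos s)]
    exact Nat.mul_div_le _ _
  have hn : (n : ℤ) = (s + 1) * α + β := by exact_mod_cast hdm.symm
  zify at h hdiv
  rw [hn] at hphi
  have : 2 * phi s 2 q n = α * ((s + 1) * α + 2 * β) * s + 2 * ((β.choose 2 : ℕ) : ℤ) := by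
    rw [hphi, h2]; ring
  linarith

end UpperBound

/-! ### Three levels, five factors: nine unconfounded interactions are impossible. -/

section ThreeLevels

/-- A permutation of the three levels is determined by two values. -/
lemma injective_zmod_three {g : ZMod 3 → ZMod 3} (hg : Function.Injective g) :
    g 0 ≠ g 1 ∧ g 2 = -(g 0 + g 1) := by
  have h01 : g 0 ≠ g 1 := hg.ne (by decide)
  have h02 : g 0 ≠ g 2 := hg.ne (by decide)
  have h12 : g 1 ≠ g 2 := hg.ne (by decide)
  refine ⟨h01, ?_⟩
  generalize g 0 = a at *
  generalize g 1 = b at *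
  generalize g 2 = c at *
  revert a b c
  decide

set_option synthInstance.maxHeartbeats 200000 in
set_option synthInstance.maxSize 2000 in
/-- Latin squares of order three are affine. -/
lemma latin_square_affine {f : ZMod 3 → ZMod 3 → ZMod 3}
    (h1 : ∀ y, Function.Injective fun x => f x y) (h2 : ∀ x, Function.Injective (f x))
    (x y : ZMod 3) : f x y = f 0 0 + x * (f 1 0 - f 0 0) + y * (f 0 1 - f 0 0) := by
  have hx0 := injective_zmod_three (h2 0)
  have hx1 := injective_zmod_three (h2 1)
  have hx2 := injective_zmod_three (h2 2)
  have hy0 := injective_zmod_three (h1 0)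
  have hy1 := injective_zmod_three (h1 1)
  have hy2 := injective_zmod_three (h1 2)
  -- The entries of a line sum to zero, so the corner with rows `a b` and `c e` determines the
  -- square; the Latin property leaves one value for `e`.
  have key : ∀ a b c e : ZMod 3, a ≠ b → a ≠ c → b ≠ e → c ≠ e → -(a + c) ≠ -(b + e) →
      -(a + b) ≠ -(c + e) → e = b + c - a := by decide
  have h11 : f 1 1 = f 0 1 + f 1 0 - f 0 0 := by
    refine key _ _ _ _ hx0.1 hy0.1 hy1.1 hx1.1 ?_ ?_
    · rw [← hy0.2, ← hy1.2]; exact hx2.1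
    · rw [← hx0.2, ← hx1.2]; exact hy2.1
  have h3 : (3 : ZMod 3) = 0 := rfl
  have hcases : ∀ z : ZMod 3, z = 0 ∨ z = 1 ∨ z = 2 := by decide
  rcases hcases x with rfl | rfl | rfl <;> rcases hcases y with rfl | rfl | rfl
  · ring
  · ring
  · rw [hx0.2]; linear_combination (-f 0 1) * h3
  · ring
  · rw [h11]; ring
  · rw [hx1.2, h11]; linear_combination (-f 1 0 - f 0 1 + f 0 0) * h3
  · rw [hy0.2]; linear_combination (-f 1 0) * h3
  · rw [hy1.2, h11]; linear_combination (-f 0 1 - f 1 0 + f 0 0) * h3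
  · rw [hx2.2, hy0.2, hy1.2, h11]; linear_combination (f 0 0) * h3

/-- Latin hypercubes of order three and dimension four are affine. -/
lemma latin_hypercube_affine {f : ZMod 3 → ZMod 3 → ZMod 3 → ZMod 3 → ZMod 3}
    (h1 : ∀ y z w, Function.Injective fun x => f x y z w)
    (h2 : ∀ x z w, Function.Injective fun y => f x y z w)
    (h3 : ∀ x y w, Function.Injective fun z => f x y z w)
    (h4 : ∀ x y z, Function.Injective fun w => f x y z w) :
    ∃ c α β γ δ : ZMod 3, α ≠ 0 ∧ β ≠ 0 ∧ γ ≠ 0 ∧ δ ≠ 0 ∧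
      ∀ x y z w, f x y z w = c + α * x + β * y + γ * z + δ * w := by
  refine ⟨f 0 0 0 0, f 1 0 0 0 - f 0 0 0 0, f 0 1 0 0 - f 0 0 0 0, f 0 0 1 0 - f 0 0 0 0,
    f 0 0 0 1 - f 0 0 0 0, sub_ne_zero.2 ((h1 0 0 0).ne (by decide)),
    sub_ne_zero.2 ((h2 0 0 0).ne (by decide)), sub_ne_zero.2 ((h3 0 0 0).ne (by decide)),
    sub_ne_zero.2 ((h4 0 0 0).ne (by decide)), fun x y z w => ?_⟩
  -- Plane sections are Latin squares, hence affine. The section in `z`, `w` gives slopes depending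
  -- on `x` and `y`; the differences of the further sections show that they do not.
  have hzw := latin_square_affine (f := fun z w => f x y z w) (h3 x y) (h4 x y) z w
  have hxz := latin_square_affine (f := fun x z => f x y z 0) (fun z => h1 y z 0)
    (fun x => h3 x y 0) x 1
  have hxw := latin_square_affine (f := fun x w => f x y 0 w) (fun w => h1 y 0 w)
    (fun x => h4 x y 0) x 1
  have hx := latin_square_affine (f := fun x z => f x y z 0) (fun z => h1 y z 0)
    (fun x => h3 x y 0) x 0
  have hyz := latin_square_affine (f := fun y z => f 0 y z 0) (fun z => h2 0 z 0)
    (fun y => h3 0 y 0) y 1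
  have hy := latin_square_affine (f := fun y z => f 0 y z 0) (fun z => h2 0 z 0)
    (fun y => h3 0 y 0) y 0
  have hyw := latin_square_affine (f := fun y w => f 0 y 0 w) (fun w => h2 0 0 w)
    (fun y => h4 0 y 0) y 1
  have hxy := latin_square_affine (f := fun x y => f x y 0 0) (fun y => h1 y 0 0)
    (fun x => h2 x 0 0) x y
  linear_combination hzw + z * (hxz - hx) + w * (hxw - hx) + z * (hyz - hy) + w * (hyw - hy) + hxy

/-- In an orthogonal array with nine runs and three levels, every factor is an affine function of any
two others. -/
lemma affine_of_injective_pairs {T : Type*} [Fintype T] (hT : Fintype.card T = 9)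
    {x y z : T → ZMod 3} (hxy : Function.Injective fun t => (x t, y t))
    (hxz : Function.Injective fun t => (x t, z t)) (hyz : Function.Injective fun t => (y t, z t)) :
    ∃ c α β : ZMod 3, α ≠ 0 ∧ β ≠ 0 ∧ ∀ t, z t = c + α * x t + β * y t := by
  -- With nine runs, `(x, y)` are coordinates and `z` is a Latin square in them.
  have hbij : Function.Bijective fun t => (x t, y t) := by
    rw [Fintype.bijective_iff_injective_and_card]
    exact ⟨hxy, by simp [hT, ZMod.card]⟩
  let g := Equiv.ofBijective _ hbij
  have hg : ∀ u v, x (g.symm (u, v)) = u ∧ y (g.symm (u, v)) = v := fun u v =>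
    Prod.ext_iff.1 (g.apply_symm_apply (u, v))
  have h1 : ∀ v, Function.Injective fun u => z (g.symm (u, v)) := by
    intro v u u' h
    have := hyz (Prod.ext ((hg u v).2.trans (hg u' v).2.symm) h)
    rw [← (hg u v).1, this, (hg u' v).1]
  have h2 : ∀ u, Function.Injective fun v => z (g.symm (u, v)) := by
    intro u v v' h
    have := hxz (Prod.ext ((hg u v).1.trans (hg u v').1.symm) h)
    rw [← (hg u v).2, this, (hg u v').2]
  refine ⟨z (g.symm (0, 0)), z (g.symm (1, 0)) - z (g.symm (0, 0)),
    z (g.symm (0, 1)) - z (g.symm (0, 0)), sub_ne_zero.2 ((h1 0).ne (by decide)),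
    sub_ne_zero.2 ((h2 0).ne (by decide)), fun t => ?_⟩
  have h := latin_square_affine (f := fun u v => z (g.symm (u, v))) h1 h2 (x t) (y t)
  have ht : g.symm (x t, y t) = t := g.symm_apply_apply t
  simp only [ht] at h
  rw [h]
  ring

/-- Affine factors forming injective pairs have independent coefficient vectors. -/
lemma det_ne_zero_of_injective_pair {T : Type*} [Fintype T] (hT : Fintype.card T = 9)
    {x y z w : T → ZMod 3} {c α β c' α' β' : ZMod 3} (hα : α ≠ 0 ∨ β ≠ 0)
    (hxy : Function.Injective fun t => (x t, y t)) (hzw : Function.Injective fun t => (z t, w t))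
    (hz : ∀ t, z t = c + α * x t + β * y t) (hw : ∀ t, w t = c' + α' * x t + β' * y t) :
    α * β' - α' * β ≠ 0 := by
  intro h0
  have hbij : Function.Bijective fun t => (x t, y t) := by
    rw [Fintype.bijective_iff_injective_and_card]
    exact ⟨hxy, by simp [hT, ZMod.card]⟩
  obtain ⟨t, ht⟩ := hbij.surjective (0, 0)
  -- The direction `(β, -α)` annihilates the linear part of `z`, and that of `w` too if the
  -- determinant vanishes.
  obtain ⟨t', ht'⟩ := hbij.surjective (β, -α)
  obtain ⟨hx, hy⟩ := Prod.ext_iff.1 ht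
  obtain ⟨hx', hy'⟩ := Prod.ext_iff.1 ht'
  simp only at hx hy hx' hy'
  have htt : t = t' := by
    refine hzw (Prod.ext ?_ ?_)
    · simp only [hz, hx, hy, hx', hy']; ring
    · simp only [hw, hx, hy, hx', hy']; linear_combination h0
  rw [htt, hy'] at hy
  rw [htt, hx'] at hx
  exact hα.elim (fun h => h (neg_eq_zero.1 hy)) fun h => h hx

set_option synthInstance.maxHeartbeats 200000 in
set_option synthInstance.maxSize 2000 in
/-- If the last of five factors is the sum of the others up to a constant, and all pairs of factors
but the last one form orthogonal arrays with nine runs, then the last two differ by a constant. -/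
lemma sub_const_of_injective_pairs {T : Type*} [Fintype T] (hT : Fintype.card T = 9)
    {x y z u v : T → ZMod 3} {c : ZMod 3} (hxy : Function.Injective fun t => (x t, y t))
    (hxz : Function.Injective fun t => (x t, z t)) (hyz : Function.Injective fun t => (y t, z t))
    (hxu : Function.Injective fun t => (x t, u t)) (hyu : Function.Injective fun t => (y t, u t))
    (hzu : Function.Injective fun t => (z t, u t)) (hxv : Function.Injective fun t => (x t, v t))
    (hyv : Function.Injective fun t => (y t, v t)) (hzv : Function.Injective fun t => (z t, v t))
    (hv : ∀ t, v t = c + x t + y t + z t + u t) (t t' : T) : v t - u t = v t' - u t' := by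
  obtain ⟨c₁, α, β, hα, hβ, hz⟩ := affine_of_injective_pairs hT hxy hxz hyz
  obtain ⟨c₂, α', β', hα', hβ', hu⟩ := affine_of_injective_pairs hT hxy hxu hyu
  have hv' : ∀ t, v t = (c + c₁ + c₂) + (1 + α + α') * x t + (1 + β + β') * y t := by
    intro t; rw [hv, hz, hu]; ring
  have h1 := det_ne_zero_of_injective_pair hT (.inl hα) hxy hzu hz hu
  have h2 := det_ne_zero_of_injective_pair hT (.inl hα) hxy hzv hz hv'
  have h3 := det_ne_zero_of_injective_pair (c := 0) (α := 1) (β := 0) hT (.inl one_ne_zero) hxy hxv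
    (fun t => by ring) hv'
  have h4 := det_ne_zero_of_injective_pair (c := 0) (α := 0) (β := 1) hT (.inr one_ne_zero) hxy hyv
    (fun t => by ring) hv'
  -- The four determinants belong to the pairs `z, u`, `z, v`, `x, v`, `y, v`. They force `x + y +
  -- z` to be constant, and `v - u` with it.
  have key : ∀ α β α' β' : ZMod 3, α ≠ 0 → β ≠ 0 → α' ≠ 0 → β' ≠ 0 → α * β' - α' * β ≠ 0 →
      α * (1 + β + β') - (1 + α + α') * β ≠ 0 → 1 * (1 + β + β') - (1 + α + α') * 0 ≠ 0 →
      0 * (1 + β + β') - (1 + α + α') * 1 ≠ 0 → α = -1 ∧ β = -1 := by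
    decide
  obtain ⟨rfl, rfl⟩ := key α β α' β' hα hβ hα' hβ' h1 h2 h3 h4
  rw [hv', hv', hu, hu]
  ring

variable {σ : ℝ}

/-- Two cells of a row agree in at most one of two factors with unconfounded interaction. -/
lemma injective_pair_row (hσ : 0 < σ) {n : ℕ} {d : RowColumnDesign 3 2 2 n}
    (hmain : MainEffectsUnconfounded σ d) {l m : Fin n} (hlm : (unconfoundedGraph σ d).Adj l m)
    (i : Fin 2 → ZMod 3) : Function.Injective fun j => (d i j l, d i j m) := by
  intro j j' h
  have hc := card_pair_of_sum_pairContrast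
    (sum_pairContrast_row hσ hmain hlm (d i j l) (d i j m) i)
  simp only [Fintype.card_fun, ZMod.card, Fintype.card_fin] at hc
  obtain ⟨h1, h2⟩ := Prod.mk.inj h
  exact Finset.card_le_one.1 (Nat.eq_of_mul_eq_mul_left (by norm_num)
    (hc.trans (mul_one _).symm)).le j (by simp) j' (by simp [h1, h2])

lemma injective_pair_col (hσ : 0 < σ) {n : ℕ} {d : RowColumnDesign 3 2 2 n}
    (hmain : MainEffectsUnconfounded σ d) {l m : Fin n} (hlm : (unconfoundedGraph σ d).Adj l m)
    (j : Fin 2 → ZMod 3) : Function.Injective fun i => (d i j l, d i j m) := by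
  intro i i' h
  have hc := card_pair_of_sum_pairContrast
    (sum_pairContrast_col hσ hmain hlm (d i j l) (d i j m) j)
  simp only [Fintype.card_fun, ZMod.card, Fintype.card_fin] at hc
  obtain ⟨h1, h2⟩ := Prod.mk.inj h
  exact Finset.card_le_one.1 (Nat.eq_of_mul_eq_mul_left (by norm_num)
    (hc.trans (mul_one _).symm)).le i (by simp) i' (by simp [h1, h2])

/-- No two cells agree in four factors that form two pairs with unconfounded interactions. -/
lemma eq_of_agree_four (hσ : 0 < σ) {n : ℕ} {d : RowColumnDesign 3 2 2 n}
    (hmain : MainEffectsUnconfounded σ d) {l m i j : Fin n}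
    (hlm : (unconfoundedGraph σ d).Adj l m) (hij : (unconfoundedGraph σ d).Adj i j) (hli : l ≠ i)
    (hlj : l ≠ j) (hmi : m ≠ i) (hmj : m ≠ j) {k k' : Cell 3 2 2}
    (h1 : d k.1 k.2 l = d k'.1 k'.2 l) (h2 : d k.1 k.2 m = d k'.1 k'.2 m)
    (h3 : d k.1 k.2 i = d k'.1 k'.2 i) (h4 : d k.1 k.2 j = d k'.1 k'.2 j) : k = k' := by
  have htot : ∀ {l m : Fin n}, (unconfoundedGraph σ d).Adj l m → ∀ a b,
      ∑ k : Cell 3 2 2, pairContrast a b (d k.1 k.2 l) (d k.1 k.2 m) = 0 := by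
    intro l m hlm a b
    rw [Fintype.sum_prod_type]
    exact Finset.sum_eq_zero fun i _ => sum_pairContrast_row hσ hmain hlm a b i
  set a := d k.1 k.2 l
  set b := d k.1 k.2 m
  set a' := d k.1 k.2 i
  set b' := d k.1 k.2 j
  have hprod := sum_pairContrast_mul_pairContrast hσ hmain hlm hij.ne hli hlj hmi hmj a b a' b'
  have hA := htot hlm a b
  have hB := htot hij a' b'
  -- With indicators `P` and `Q` this expands `(3P - 1/3)(3Q - 1/3)`. Summing over 81 cells gives
  -- nine times the frequency of the four levels, minus nine; so the frequency is one.
  have hexp : ∑ k : Cell 3 2 2, pairContrast a b (d k.1 k.2 l) (d k.1 k.2 m) *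
      pairContrast a' b' (d k.1 k.2 i) (d k.1 k.2 j) =
      ∑ k : Cell 3 2 2, (9 * (if (d k.1 k.2 l = a ∧ d k.1 k.2 m = b) ∧
        (d k.1 k.2 i = a' ∧ d k.1 k.2 j = b') then (1 : ℝ) else 0) -
      (1 / 3) * pairContrast a b (d k.1 k.2 l) (d k.1 k.2 m) -
      (1 / 3) * pairContrast a' b' (d k.1 k.2 i) (d k.1 k.2 j) - 1 / 9) := by
    refine Finset.sum_congr rfl fun k _ => ?_
    by_cases hP : d k.1 k.2 l = a ∧ d k.1 k.2 m = b <;>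
      by_cases hQ : d k.1 k.2 i = a' ∧ d k.1 k.2 j = b' <;>
      simp only [pairContrast, hP, hQ, and_self, and_true, and_false,
        if_true, if_false] <;> norm_num
  rw [hexp, Finset.sum_sub_distrib, Finset.sum_sub_distrib, Finset.sum_sub_distrib,
    ← Finset.mul_sum, ← Finset.mul_sum, ← Finset.mul_sum, hA, hB, Finset.sum_boole] at hprod
  simp only [Finset.sum_const, Finset.card_univ, Fintype.card_prod, Fintype.card_fun, ZMod.card,
    Fintype.card_fin, nsmul_eq_mul] at hprod
  have hone : (Finset.univ.filter fun k : Cell 3 2 2 => (d k.1 k.2 l = a ∧ d k.1 k.2 m = b) ∧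
      (d k.1 k.2 i = a' ∧ d k.1 k.2 j = b')).card = 1 := by
    have : ((Finset.univ.filter fun k : Cell 3 2 2 => (d k.1 k.2 l = a ∧ d k.1 k.2 m = b) ∧
      (d k.1 k.2 i = a' ∧ d k.1 k.2 j = b')).card : ℝ) = 1 := by
      norm_num at hprod
      linarith
    exact_mod_cast this
  exact Finset.card_le_one.1 hone.le k (by simp [a, b, a', b'])
    k' (by simp [← h1, ← h2, ← h3, ← h4])

/-- A `9 × 9` array with five factors has at least two confounded interactions. -/
lemma exists_not_adj (hσ : 0 < σ) {n : ℕ} {d : RowColumnDesign 3 2 2 n}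
    (hmain : MainEffectsUnconfounded σ d) {i j k a b : Fin n}
    (hij : (unconfoundedGraph σ d).Adj i j) (hik : (unconfoundedGraph σ d).Adj i k)
    (hjk : (unconfoundedGraph σ d).Adj j k) (hia : (unconfoundedGraph σ d).Adj i a)
    (hja : (unconfoundedGraph σ d).Adj j a) (hka : (unconfoundedGraph σ d).Adj k a)
    (hib : (unconfoundedGraph σ d).Adj i b) (hjb : (unconfoundedGraph σ d).Adj j b)
    (hkb : (unconfoundedGraph σ d).Adj k b) (hab : a ≠ b) : False := by
  let X : Cell 3 2 2 → Fin n → ZMod 3 := fun c => d c.1 c.2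
  have hijka : ∀ c c', X c i = X c' i → X c j = X c' j → X c k = X c' k → X c a = X c' a → c = c' :=
    -- Each set of four factors splits into two adjacent pairs avoiding `{a, b}`, so any four
    -- factors determine the cell.
    fun c c' h1 h2 h3 h4 => eq_of_agree_four hσ hmain hij hka hik.ne hia.ne hjk.ne hja.ne h1 h2 h3 h4
  have hijkb : ∀ c c', X c i = X c' i → X c j = X c' j → X c k = X c' k → X c b = X c' b → c = c' :=
    fun c c' h1 h2 h3 h4 => eq_of_agree_four hσ hmain hij hkb hik.ne hib.ne hjk.ne hjb.ne h1 h2 h3 h4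
  have hijab : ∀ c c', X c i = X c' i → X c j = X c' j → X c a = X c' a → X c b = X c' b → c = c' :=
    fun c c' h1 h2 h3 h4 =>
      eq_of_agree_four hσ hmain hia hjb hij.ne hib.ne hja.ne.symm hab h1 h3 h2 h4
  have hikab : ∀ c c', X c i = X c' i → X c k = X c' k → X c a = X c' a → X c b = X c' b → c = c' :=
    fun c c' h1 h2 h3 h4 =>
      eq_of_agree_four hσ hmain hia hkb hik.ne hib.ne hka.ne.symm hab h1 h3 h2 h4
  have hjkab : ∀ c c', X c j = X c' j → X c k = X c' k → X c a = X c' a → X c b = X c' b → c = c' :=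
    fun c c' h1 h2 h3 h4 =>
      eq_of_agree_four hσ hmain hja hkb hjk.ne hjb.ne hka.ne.symm hab h1 h3 h2 h4
  have hbij : Function.Bijective fun c => (X c i, X c j, X c k, X c a) := by
    rw [Fintype.bijective_iff_injective_and_card]
    refine ⟨fun c c' h => ?_, by simp [ZMod.card]⟩
    simp only [Prod.mk.injEq] at h
    exact hijka c c' h.1 h.2.1 h.2.2.1 h.2.2.2
  let g := Equiv.ofBijective _ hbij
  have hg : ∀ x y z w, X (g.symm (x, y, z, w)) i = x ∧ X (g.symm (x, y, z, w)) j = y ∧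
      X (g.symm (x, y, z, w)) k = z ∧ X (g.symm (x, y, z, w)) a = w := by
    intro x y z w
    have h := g.apply_symm_apply (x, y, z, w)
    have h' : (X (g.symm (x, y, z, w)) i, X (g.symm (x, y, z, w)) j, X (g.symm (x, y, z, w)) k,
      X (g.symm (x, y, z, w)) a) = (x, y, z, w) := h
    simpa only [Prod.mk.injEq] using h'
  obtain ⟨c, α, β, γ, δ, hα, hβ, hγ, hδ, hf⟩ :=
    latin_hypercube_affine (f := fun x y z w => X (g.symm (x, y, z, w)) b)
    (fun y z w x x' h => by
      obtain ⟨h1, h2, h3, h4⟩ := hg x y z w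
      obtain ⟨h1', h2', h3', h4'⟩ := hg x' y z w
      rw [← h1, hjkab _ _ (h2.trans h2'.symm) (h3.trans h3'.symm) (h4.trans h4'.symm) h, h1'])
    (fun x z w y y' h => by
      obtain ⟨h1, h2, h3, h4⟩ := hg x y z w
      obtain ⟨h1', h2', h3', h4'⟩ := hg x y' z w
      rw [← h2, hikab _ _ (h1.trans h1'.symm) (h3.trans h3'.symm) (h4.trans h4'.symm) h, h2'])
    (fun x y w z z' h => by
      obtain ⟨h1, h2, h3, h4⟩ := hg x y z w
      obtain ⟨h1', h2', h3', h4'⟩ := hg x y z' w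
      rw [← h3, hijab _ _ (h1.trans h1'.symm) (h2.trans h2'.symm) (h4.trans h4'.symm) h, h3'])
    (fun x y z w w' h => by
      obtain ⟨h1, h2, h3, h4⟩ := hg x y z w
      obtain ⟨h1', h2', h3', h4'⟩ := hg x y z w'
      rw [← h4, hijkb _ _ (h1.trans h1'.symm) (h2.trans h2'.symm) (h3.trans h3'.symm) h, h4'])
  have hX : ∀ k' : Cell 3 2 2, X k' b = c + α * X k' i + β * X k' j + γ * X k' k + δ * X k' a := by
    intro k'
    have h := hf (X k' i) (X k' j) (X k' k) (X k' a)
    have hk : g.symm (X k' i, X k' j, X k' k, X k' a) = k' := g.symm_apply_apply k'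
    rwa [hk] at h
  have hscale : ∀ {T : Type} {x y : T → ZMod 3} {u v : ZMod 3}, u ≠ 0 → v ≠ 0 →
      Function.Injective (fun t => (x t, y t)) → Function.Injective fun t => (u * x t, v * y t) := by
    intro T x y u v hu hv h t t' ht
    obtain ⟨h1, h2⟩ := Prod.ext_iff.1 ht
    exact h (Prod.ext (mul_left_cancel₀ hu h1) (mul_left_cancel₀ hv h2))
  -- `x` parametrises a row or a column. Scaling the four coordinate factors by `α`, `β`, `γ`, `δ`
  -- makes `b` their sum up to a constant.
  have hline : ∀ (x : (Fin 2 → ZMod 3) → Cell 3 2 2), (∀ {l m},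
      (unconfoundedGraph σ d).Adj l m → Function.Injective fun t => (X (x t) l, X (x t) m)) →
      ∀ t t', X (x t) b - δ * X (x t) a = X (x t') b - δ * X (x t') a := by
    intro x hx t t'
    have h := sub_const_of_injective_pairs (c := c) (v := fun t => 1 * X (x t) b) (by simp [ZMod.card])
      (hscale hα hβ (hx hij)) (hscale hα hγ (hx hik)) (hscale hβ hγ (hx hjk))
      (hscale hα hδ (hx hia)) (hscale hβ hδ (hx hja)) (hscale hγ hδ (hx hka))
      (hscale hα one_ne_zero (hx hib)) (hscale hβ one_ne_zero (hx hjb))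
      (hscale hγ one_ne_zero (hx hkb)) (fun t => by rw [hX]; ring) t t'
    simpa only [one_mul] using h
  have hrow : ∀ r t t', X (r, t) b - δ * X (r, t) a = X (r, t') b - δ * X (r, t') a := fun r =>
    hline (fun t => (r, t)) fun h => injective_pair_row hσ hmain h r
  have hcol : ∀ r t t', X (t, r) b - δ * X (t, r) a = X (t', r) b - δ * X (t', r) a := fun r =>
    hline (fun t => (t, r)) fun h => injective_pair_col hσ hmain h r
  have hconst : ∀ k k' : Cell 3 2 2, X k b - δ * X k a = X k' b - δ * X k' a := fun k k' =>
    (hrow k.1 k.2 k'.2).trans (hcol k'.2 k.1 k'.1)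
  -- These two cells differ in factor `i` only among `i`, `j`, `k`, `a`, so constancy of `b - δ * a`
  -- would give `α = 0`.
  obtain ⟨h1, h2, h3, h4⟩ := hg 0 0 0 0
  obtain ⟨h1', h2', h3', h4'⟩ := hg 1 0 0 0
  have h := hconst (g.symm (0, 0, 0, 0)) (g.symm (1, 0, 0, 0))
  rw [hX, hX, h1, h2, h3, h4, h1', h2', h3', h4'] at h
  apply hα
  linear_combination -h

set_option synthInstance.maxHeartbeats 200000 in
set_option synthInstance.maxSize 2000 in
/-- A `9 × 9` array with five factors all of whose main effects are unconfounded has at most eight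
unconfounded interactions. -/
lemma numUnconfounded_le_eight (hσ : 0 < σ) {d : RowColumnDesign 3 2 2 5}
    (hmain : MainEffectsUnconfounded σ d) : numUnconfounded σ d ≤ 8 := by
  classical
  rw [numUnconfounded_eq_card_edgeFinset]
  by_contra! hlt
  obtain ⟨a, b, hab, hadj⟩ : ∃ a b : Fin 5, a ≠ b ∧ ∀ l m, l ≠ m → s(l, m) ≠ s(a, b) →
      (unconfoundedGraph σ d).Adj l m := by
    set G := unconfoundedGraph σ d
    have hcompl : Gᶜ.edgeFinset.card ≤ 1 := by
      have h : (G ⊔ Gᶜ).edgeFinset.card = G.edgeFinset.card + Gᶜ.edgeFinset.card := by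
        rw [SimpleGraph.edgeFinset_sup, Finset.card_union_of_disjoint]
        exact SimpleGraph.disjoint_edgeFinset.2 disjoint_compl_right
      have h' : (G ⊔ Gᶜ).edgeFinset.card = Nat.choose 5 2 := by
        have htop : (G ⊔ Gᶜ).edgeFinset = (⊤ : SimpleGraph (Fin 5)).edgeFinset := by
          ext e
          simp only [SimpleGraph.mem_edgeFinset, sup_compl_eq_top]
        rw [htop, SimpleGraph.card_edgeFinset_top_eq_card_choose_two, Fintype.card_fin]
      rw [h'] at h
      norm_num [Nat.choose] at h
      omega
    by_cases he : ∃ a b, Gᶜ.Adj a b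
    · obtain ⟨a, b, hab⟩ := he
      refine ⟨a, b, hab.ne, fun l m hlm hne => ?_⟩
      by_contra hadj
      have h1 : s(l, m) ∈ Gᶜ.edgeFinset := by
        rw [SimpleGraph.mem_edgeFinset]; exact ⟨hlm, hadj⟩
      have h2 : s(a, b) ∈ Gᶜ.edgeFinset := by
        rw [SimpleGraph.mem_edgeFinset]; exact hab
      exact hne (Finset.card_le_one.1 hcompl _ h1 _ h2)
    · push Not at he
      -- If no edge is missing, any pair can play the part of the missing one.
      refine ⟨3, 4, by decide, fun l m hlm _ => ?_⟩
      by_contra hadj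
      exact he l m ⟨hlm, hadj⟩
  have hex : ∀ a b : Fin 5, a ≠ b → ∃ i j k : Fin 5, i ≠ j ∧ i ≠ k ∧
      j ≠ k ∧ i ≠ a ∧ j ≠ a ∧ k ≠ a ∧ i ≠ b ∧ j ≠ b ∧ k ≠ b := by
    decide
  obtain ⟨i, j, k, hij, hik, hjk, hia, hja, hka, hib, hjb, hkb⟩ := hex a b hab
  refine exists_not_adj hσ hmain (i := i) (j := j) (k := k) (a := a) (b := b) (hadj _ _ hij ?_)
    (hadj _ _ hik ?_) (hadj _ _ hjk ?_) (hadj _ _ hia ?_) (hadj _ _ hja ?_) (hadj _ _ hka ?_)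
    (hadj _ _ hib ?_) (hadj _ _ hjb ?_) (hadj _ _ hkb ?_) hab <;>
  simp [hia, hja, hka, hib, hjb, hkb]

end ThreeLevels

/-! ### Designs from array generator matrices: effects as linear forms. -/

section GeneratedDesigns

variable {s p q n : ℕ}

/-- The coefficient vector of a treatment effect. -/
def Effect.coeff : Effect s n → Fin n → ZMod s
  | Sum.inl l => Pi.single l 1
  | Sum.inr t => Pi.single t.1.1 1 + Pi.single t.1.2.1 t.1.2.2

lemma Effect.level_eq_dotProduct (x : Fin n → ZMod s) (e : Effect s n) :
    Effect.level x e = x ⬝ᵥ e.coeff := by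
  rcases e with l | t
  · simp [Effect.level, Effect.coeff]
  · simp [Effect.level, Effect.coeff, dotProduct_add, mul_comm]

/-- The level of an effect as a linear function of the labels of row and column. -/
def levelMap (Gc : Matrix (Fin p) (Fin n) (ZMod s)) (Gr : Matrix (Fin q) (Fin n) (ZMod s))
    (e : Effect s n) : Cell s p q →ₗ[ZMod s] ZMod s where
  toFun k := k.1 ⬝ᵥ (Gc *ᵥ e.coeff) + k.2 ⬝ᵥ (Gr *ᵥ e.coeff)
  map_add' k k' := by simp [add_dotProduct]; ring
  map_smul' a k := by simp [mul_add]

lemma level_generatedDesign (Gc : Matrix (Fin p) (Fin n) (ZMod s))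
    (Gr : Matrix (Fin q) (Fin n) (ZMod s)) (e : Effect s n) (k : Cell s p q) :
    Effect.level (generatedDesign Gc Gr k.1 k.2) e = levelMap Gc Gr e k := by
  simp [Effect.level_eq_dotProduct, generatedDesign, levelMap, add_dotProduct, dotProduct_mulVec]

variable [Fact s.Prime]

/-- A contrast of a linear function is orthogonal to every function that is invariant under a
direction in which the linear function is not constant. -/
lemma sum_contrast_mul_eq_zero {A : Type*} [AddCommGroup A] [Module (ZMod s) A] [Fintype A]
    (f : A →ₗ[ZMod s] ZMod s) (h : A → ℝ) (k : A) (hk : f k = 1)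
    (hh : ∀ x (a : ZMod s), h (x + a • k) = h x) {t : ZMod s → ℝ} (ht : ∑ u, t u = 0) :
    ∑ x, t (f x) * h x = 0 := by
  -- Translation by `a • k` shifts `f` by `a` and preserves `h`; averaging over all `a` replaces `t`
  -- by its sum, which is zero.
  have hshift : ∀ a : ZMod s, ∑ x, t (f x) * h x = ∑ x, t (f x + a) * h x := by
    intro a
    rw [← Equiv.sum_comp (Equiv.addRight (a • k))]
    exact Finset.sum_congr rfl fun x _ => by simp [hh, hk]
  have hsum : ∑ _a : ZMod s, ∑ x, t (f x) * h x = 0 := by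
    rw [Finset.sum_congr rfl fun a _ => hshift a, Finset.sum_comm]
    refine Finset.sum_eq_zero fun x _ => ?_
    have h1 : ∑ u, t (f x + u) = 0 := (Equiv.sum_comp (Equiv.addLeft (f x)) t).trans ht
    rw [← Finset.sum_mul, h1, zero_mul]
  simpa [ZMod.card, NeZero.ne s] using hsum

/-- Contrasts of two linearly independent linear functions are orthogonal. -/
lemma sum_contrast_mul_contrast_eq_zero {A : Type*} [AddCommGroup A] [Module (ZMod s) A] [Fintype A]
    {f f' : A →ₗ[ZMod s] ZMod s} (hf : ∀ a : ZMod s, f ≠ a • f') {t : ZMod s → ℝ}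
    (ht : ∑ u, t u = 0) (t' : ZMod s → ℝ) : ∑ x, t (f x) * t' (f' x) = 0 := by
  -- If `f` vanished on the kernel of `f'`, it would be a multiple of `f'`.
  obtain ⟨k, hk, hk'⟩ : ∃ k, f' k = 0 ∧ f k ≠ 0 := by
    by_contra! hall
    have hmem := mem_span_of_iInf_ker_le_ker (ι := Unit) (L := fun _ => f') (K := f)
      (by intro x hx; simpa using hall x (by simpa using hx))
    rw [Set.range_const, Submodule.mem_span_singleton] at hmem
    obtain ⟨a, ha⟩ := hmem
    exact hf a ha.symm
  refine sum_contrast_mul_eq_zero f (fun x => t' (f' x)) ((f k)⁻¹ • k) ?_ ?_ ht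
  · simp [hk']
  · intro x a
    simp [hk]

/-- Within a fixed row or column the level of an effect has the form `x ⬝ᵥ c + b`; this yields
orthogonality to row and column effects. -/
lemma sum_contrast_dotProduct {m : ℕ} {c : Fin m → ZMod s} (hc : c ≠ 0) (b : ZMod s)
    {t : ZMod s → ℝ} (ht : ∑ u, t u = 0) : ∑ x, t (x ⬝ᵥ c + b) = 0 := by
  obtain ⟨i, hi⟩ := Function.ne_iff.1 hc
  have h := sum_contrast_mul_eq_zero (dotProductBilin (ZMod s) (ZMod s) |>.flip c) (fun _ => 1)
    (Pi.single i (c i)⁻¹) (by simpa using inv_mul_cancel₀ hi) (fun _ _ => rfl)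
    (t := fun u => t (u + b)) ((Equiv.sum_comp (Equiv.addRight b) t).trans ht)
  simpa using h

/-- Two effects together involve at most four factors, which is why four independent columns
suffice. For a main effect `l = m`. -/
lemma Effect.exists_support (e : Effect s n) :
    ∃ l m, ∀ i, i ≠ l → i ≠ m → e.coeff i = 0 := by
  rcases e with l | t
  · exact ⟨l, l, fun i hi _ => by simp [Effect.coeff, hi]⟩
  · exact ⟨t.1.1, t.1.2.1, fun i hi hi' => by simp [Effect.coeff, hi, hi']⟩

/-- Coefficient vectors of different effects are not proportional. -/
lemma Effect.coeff_ne_smul {e e' : Effect s n} (h : e ≠ e') (a : ZMod s) :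
    e.coeff ≠ a • e'.coeff := by
  intro hc
  have hc' : ∀ i, e.coeff i = a * e'.coeff i := fun i => congrFun hc i
  rcases e with l | ⟨⟨l, m, v⟩, hlm, hv⟩ <;> rcases e' with l' | ⟨⟨l', m', v'⟩, hlm', hv'⟩ <;>
    simp only [Effect.coeff, Pi.add_apply] at hc'
  · have hne : l ≠ l' := fun h' => h (by rw [h'])
    simpa [hne] using hc' l
  · by_cases h1 : l' = l
    · subst h1
      have ha := hc' m'
      have h0 := hc' l'
      simp only [ne_eq] at hv' hlm'
      simp [hlm'.ne, hlm'.ne', hv'] at ha h0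
      simp [ha] at h0
    · have ha := hc' l'
      have h0 := hc' l
      simp only at hlm'
      simp [h1, hlm'.ne] at ha
      simp [← ha] at h0
  · by_cases h1 : l = l'
    · subst h1
      have ha := hc' m
      simp only at hlm
      simp [hlm.ne'] at ha
      exact hv ha
    · have ha := hc' l
      simp only at hlm
      simp [h1, hlm.ne] at ha
  · simp only [ne_eq] at hlm hlm' hv hv'
    have hl := hc' l
    have hm := hc' m
    simp [Pi.single_apply, hlm.ne, hlm.ne'] at hl hm
    have h1 : l = l' := by
      by_contra h1
      by_cases h2 : l = m'
      · subst h2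
        simp [hlm.ne', (hlm'.trans hlm).ne'] at hm
        exact hv hm
      · simp [h1, h2] at hl
    subst h1
    have h2 : m = m' := by
      by_contra h2
      simp [h2, hlm.ne'] at hm
      exact hv hm
    subst h2
    simp [hlm.ne, hlm.ne'] at hl hm
    apply h
    simp [hm, ← hl]

/-- No nonzero linear relation involves at most four columns. -/
def FewColumnsIndependent (Gc : Matrix (Fin p) (Fin n) (ZMod s))
    (Gr : Matrix (Fin q) (Fin n) (ZMod s)) : Prop :=
  ∀ c : Fin n → ZMod s, Gc *ᵥ c = 0 → Gr *ᵥ c = 0 →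
    (Finset.univ.filter fun i => c i ≠ 0).card ≤ 4 → c = 0

variable {Gc : Matrix (Fin p) (Fin n) (ZMod s)} {Gr : Matrix (Fin q) (Fin n) (ZMod s)}

/-- Coefficients on four columns, extended by zero, form a relation with at most four nonzero
entries. -/
lemma FewColumnsIndependent.anyFourColumnsIndependent (hG : FewColumnsIndependent Gc Gr) :
    AnyFourColumnsIndependent Gc Gr := by
  classical
  intro t ht
  rw [Fintype.linearIndependent_iff]
  intro g hg
  set c : Fin n → ZMod s := fun i => if h : i ∈ t then g ⟨i, h⟩ else 0 with hcdef
  have hmul : Matrix.fromRows Gc Gr *ᵥ c = 0 := by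
    rw [← hg]
    ext r
    simp only [mulVec, dotProduct, Finset.sum_apply, Pi.smul_apply, smul_eq_mul, Matrix.col_apply]
    rw [← Finset.sum_subset (Finset.subset_univ t), ← Finset.sum_coe_sort t]
    · exact Finset.sum_congr rfl fun i _ => by simp [hcdef, mul_comm]
    · intro i _ hi
      simp [hcdef, hi]
  rw [fromRows_mulVec] at hmul
  have h0 := hG c (funext fun i => congrFun hmul (Sum.inl i))
    (funext fun i => congrFun hmul (Sum.inr i)) <| by
      rw [← ht]
      refine Finset.card_le_card fun i hi => ?_
      by_contra h
      simp [hcdef, h] at hi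
  intro i
  have := congrFun h0 i
  simpa [hcdef] using this

variable {σ : ℝ}

/-- An effect of a generated design is unconfounded if it is not confounded with rows and
columns. -/
lemma FewColumnsIndependent.isUnconfounded (hσ : 0 < σ) (hG : FewColumnsIndependent Gc Gr)
    {e : Effect s n} (hc : Gc *ᵥ e.coeff ≠ 0) (hr : Gr *ᵥ e.coeff ≠ 0) :
    IsUnconfounded σ (generatedDesign Gc Gr) e := by
  classical
  rw [isUnconfounded_iff hσ, isOrthogonalEffect_iff]
  intro t ht
  refine ⟨fun i => ?_, fun j => ?_, fun e' he t' _ => ?_⟩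
  · rw [← sum_contrast_dotProduct hr (i ⬝ᵥ (Gc *ᵥ e.coeff)) ht]
    refine Finset.sum_congr rfl fun j _ => ?_
    rw [level_generatedDesign Gc Gr e (i, j), levelMap, add_comm]
    rfl
  · rw [← sum_contrast_dotProduct hc (j ⬝ᵥ (Gr *ᵥ e.coeff)) ht]
    refine Finset.sum_congr rfl fun i _ => ?_
    rw [level_generatedDesign Gc Gr e (i, j)]
    rfl
  · simp only [level_generatedDesign]
    refine sum_contrast_mul_contrast_eq_zero (fun a ha => ?_) ht t'
    -- Proportional linear forms would give a relation among at most four columns.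
    have hsub : e.coeff - a • e'.coeff = 0 := by
      refine hG _ ?_ ?_ ?_
      · funext i
        have h := LinearMap.congr_fun ha (Pi.single i 1, 0)
        simpa [levelMap, mulVec_sub, mulVec_smul, sub_eq_zero] using h
      · funext i
        have h := LinearMap.congr_fun ha (0, Pi.single i 1)
        simpa [levelMap, mulVec_sub, mulVec_smul, sub_eq_zero] using h
      · obtain ⟨l, m, h⟩ := e.exists_support
        obtain ⟨l', m', h'⟩ := e'.exists_support
        refine (Finset.card_le_card fun i hi => ?_).trans (Finset.card_le_four (a := l) (b := m)
          (c := l') (d := m'))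
        by_contra hni
        simp only [Finset.mem_insert, Finset.mem_singleton, not_or] at hni
        simp [h i hni.1 hni.2.1, h' i hni.2.2.1 hni.2.2.2] at hi
    exact Effect.coeff_ne_smul he.symm a (sub_eq_zero.1 hsub)

/-- A linear dependency with at least five nonzero entries that generates all others. -/
lemma fewColumnsIndependent_of_null (N : Fin n → ZMod s) (j : Fin n) (S : Finset (Fin n))
    (hS : 5 ≤ S.card) (hN : ∀ i ∈ S, N i ≠ 0)
    (h : ∀ c : Fin n → ZMod s, Gc *ᵥ c = 0 → Gr *ᵥ c = 0 → ∀ i, c i = N i * c j) :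
    FewColumnsIndependent Gc Gr := by
  intro c h1 h2 h4
  have hc := h c h1 h2
  by_cases hj : c j = 0
  · funext i
    rw [hc, hj, mul_zero]
    rfl
  · have hsub : S ⊆ Finset.univ.filter fun i => c i ≠ 0 := fun i hi => by
      rw [Finset.mem_filter, hc]
      exact ⟨Finset.mem_univ _, mul_ne_zero (hN i hi) hj⟩
    have := Finset.card_le_card hsub
    omega

/-- The columns `l` and `m` of `A` are linearly independent, by a nonzero minor. -/
def HasMinor {m : ℕ} (A : Matrix (Fin m) (Fin n) (ZMod s)) (l l' : Fin n) : Prop :=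
  ∃ i j, A i l * A j l' - A j l * A i l' ≠ 0

/-- Eliminating `v` from two rows leaves the minor, so one minor settles all `s - 1` components at
once. -/
lemma HasMinor.mulVec_ne_zero {m : ℕ} {A : Matrix (Fin m) (Fin n) (ZMod s)} {l l' : Fin n}
    (h : HasMinor A l l') (v : ZMod s) : A *ᵥ (Pi.single l 1 + Pi.single l' v) ≠ 0 := by
  obtain ⟨i, j, hij⟩ := h
  intro h0
  apply hij
  have hi := congrFun h0 i
  have hj := congrFun h0 j
  simp [mulVec_add] at hi hj
  linear_combination A j l' * hi - A i l' * hj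

lemma FewColumnsIndependent.mainEffectsUnconfounded (hσ : 0 < σ) (hG : FewColumnsIndependent Gc Gr)
    (hc : ∀ l, ∃ i, Gc i l ≠ 0) (hr : ∀ l, ∃ i, Gr i l ≠ 0) :
    MainEffectsUnconfounded σ (generatedDesign Gc Gr) := by
  have key : ∀ {m : ℕ} (A : Matrix (Fin m) (Fin n) (ZMod s)) (l : Fin n), (∃ i, A i l ≠ 0) →
      A *ᵥ Effect.coeff (mainEffect s l) ≠ 0 := by
    rintro m A l ⟨i, hi⟩ h0
    apply hi
    simpa [Effect.coeff, mainEffect] using congrFun h0 i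
  exact fun l => hG.isUnconfounded hσ (key Gc l (hc l)) (key Gr l (hr l))

/-- A lower bound for the number of unconfounded interactions of a generated design. -/
lemma FewColumnsIndependent.card_le_numUnconfounded (hσ : 0 < σ)
    (hG : FewColumnsIndependent Gc Gr) (T : Finset (Fin n × Fin n)) (hT : ∀ t ∈ T, t.1 < t.2)
    (hc : ∀ t ∈ T, HasMinor Gc t.1 t.2) (hr : ∀ t ∈ T, HasMinor Gr t.1 t.2) :
    T.card ≤ numUnconfounded σ (generatedDesign Gc Gr) := by
  rw [← Set.ncard_coe_finset, numUnconfounded]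
  refine Set.ncard_le_ncard (fun t ht => ⟨hT t ht, fun v hv => ?_⟩) (Set.toFinite _)
  exact hG.isUnconfounded hσ ((hc t ht).mulVec_ne_zero v) ((hr t ht).mulVec_ne_zero v)

lemma withoutReplication_generatedDesign
    (h : ∀ z w, z ᵥ* Gc + w ᵥ* Gr = 0 → z = 0 ∧ w = 0) :
    (generatedDesign Gc Gr).WithoutReplication := by
  rintro ⟨z, w⟩ ⟨z', w'⟩ heq
  simp only [generatedDesign] at heq
  obtain ⟨h1, h2⟩ := h (z - z') (w - w') (by
    rw [sub_vecMul, sub_vecMul, sub_add_sub_comm, heq, sub_self])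
  rw [sub_eq_zero.1 h1, sub_eq_zero.1 h2]

/-- A generated design attaining Turán's bound is optimal of efficiency `1`. -/
lemma FewColumnsIndependent.yieldsOptimal_one (hσ : 0 < σ) (hq : 2 ≤ q)
    {Gc : Matrix (Fin 2) (Fin n) (ZMod s)} (hG : FewColumnsIndependent Gc Gr)
    (hinj : ∀ z w, z ᵥ* Gc + w ᵥ* Gr = 0 → z = 0 ∧ w = 0)
    (hc : ∀ l, ∃ i, Gc i l ≠ 0) (hr : ∀ l, ∃ i, Gr i l ≠ 0)
    (T : Finset (Fin n × Fin n)) (hT : ∀ t ∈ T, t.1 < t.2)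
    (hTc : ∀ t ∈ T, HasMinor Gc t.1 t.2) (hTr : ∀ t ∈ T, HasMinor Gr t.1 t.2)
    (hcard : phi s 2 q n ≤ T.card) (hpos : T.Nonempty) : YieldsOptimal σ Gc Gr 1 := by
  have hmain := hG.mainEffectsUnconfounded hσ hc hr
  have hle := hG.card_le_numUnconfounded hσ T hT hTc hTr
  have hup := numUnconfounded_le_phi hσ hq hmain
  have hTpos := hpos.card_pos
  have heq : (numUnconfounded σ (generatedDesign Gc Gr) : ℤ) = phi s 2 q n := by omega
  refine ⟨hG.anyFourColumnsIndependent,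
    ⟨withoutReplication_generatedDesign hinj, hmain, fun d' _ hd' => ?_⟩, ?_⟩
  · have := numUnconfounded_le_phi hσ hq hd'
    omega
  · rw [twoFiEfficiency, ← heq, Int.cast_natCast]
    exact div_self (Nat.cast_ne_zero.2 (by omega))

end GeneratedDesigns

/-! ### The explicit matrices for `q = 2, 3, 4`. -/

section SmallCases

variable {s q n : ℕ}

/-- The pairs of columns with `2 × 2` minors dividing `m` in both of two integer matrices. -/
def minorPairs {p : ℕ} (A : Matrix (Fin p) (Fin n) ℤ) (B : Matrix (Fin q) (Fin n) ℤ) (m : ℤ) :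
    Finset (Fin n × Fin n) :=
  Finset.univ.filter fun t => t.1 < t.2 ∧
    (∃ i j, A i t.1 * A j t.2 - A j t.1 * A i t.2 ∣ m) ∧
    ∃ i j, B i t.1 * B j t.2 - B j t.1 * B i t.2 ∣ m

variable [Fact s.Prime]

/-- Lets one decidable divisibility test over `ℤ` certify nonzero entries and minors for all primes
not dividing `m`. -/
lemma intCast_ne_zero_of_dvd {a m : ℤ} (hm : ¬ (s : ℤ) ∣ m) (h : a ∣ m) : (a : ZMod s) ≠ 0 := by
  rw [Ne, ZMod.intCast_zmod_eq_zero_iff_dvd]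
  exact fun h' => hm (h'.trans h)

lemma exists_entry_ne_zero {k : ℕ} {G : Matrix (Fin k) (Fin n) (ZMod s)}
    {A : Matrix (Fin k) (Fin n) ℤ} (hA : ∀ i j, G i j = A i j) {m : ℤ} (hm : ¬ (s : ℤ) ∣ m)
    (h : ∀ l, ∃ i, A i l ∣ m) (l : Fin n) : ∃ i, G i l ≠ 0 := by
  obtain ⟨i, hi⟩ := h l
  exact ⟨i, by rw [hA]; exact intCast_ne_zero_of_dvd hm hi⟩

lemma hasMinor_of_int {k : ℕ} {G : Matrix (Fin k) (Fin n) (ZMod s)}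
    {A : Matrix (Fin k) (Fin n) ℤ} (hA : ∀ i j, G i j = A i j) {m : ℤ} (hm : ¬ (s : ℤ) ∣ m)
    {l l' : Fin n} (h : ∃ i j, A i l * A j l' - A j l * A i l' ∣ m) : HasMinor G l l' := by
  obtain ⟨i, j, hij⟩ := h
  exact ⟨i, j, by simp only [hA]; exact_mod_cast intCast_ne_zero_of_dvd hm hij⟩

variable {σ : ℝ} {Gc : Matrix (Fin 2) (Fin n) (ZMod s)} {Gr : Matrix (Fin q) (Fin n) (ZMod s)}

lemma FewColumnsIndependent.yieldsOptimal_one_of_int (hσ : 0 < σ) (hq : 2 ≤ q)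
    (hG : FewColumnsIndependent Gc Gr) (hinj : ∀ z w, z ᵥ* Gc + w ᵥ* Gr = 0 → z = 0 ∧ w = 0)
    {A : Matrix (Fin 2) (Fin n) ℤ} {B : Matrix (Fin q) (Fin n) ℤ} (hA : ∀ i j, Gc i j = A i j)
    (hB : ∀ i j, Gr i j = B i j) {m : ℤ} (hm : ¬ (s : ℤ) ∣ m) (hc : ∀ l, ∃ i, A i l ∣ m)
    (hr : ∀ l, ∃ i, B i l ∣ m) (b : ℕ) (hb : 0 < b) (hphi : phi s 2 q n ≤ b)
    (hcard : b ≤ (minorPairs A B m).card) : YieldsOptimal σ Gc Gr 1 := by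
  refine hG.yieldsOptimal_one hσ hq hinj (exists_entry_ne_zero hA hm hc)
    (exists_entry_ne_zero hB hm hr) (minorPairs A B m) (fun t ht => ?_) (fun t ht => ?_)
    (fun t ht => ?_) (hphi.trans (by exact_mod_cast hcard)) (Finset.card_pos.1 (by omega)) <;>
  simp only [minorPairs, Finset.mem_filter] at ht
  exacts [ht.2.1, hasMinor_of_int hA hm ht.2.2.1, hasMinor_of_int hB hm ht.2.2.2]

/-- Enough when all two-factor interactions are unconfounded, as happens below for `n ≤ s + 1`. -/
lemma phi_le_choose (s p q n : ℕ) : phi s p q n ≤ n.choose 2 := by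
  simp only [phi]
  have : (0 : ℤ) ≤ ((s ^ min p q - 1) / (s - 1) : ℕ) *
      ((n / ((s ^ min p q - 1) / (s - 1))).choose 2 : ℕ) := by positivity
  have h2 : (0 : ℤ) ≤ (n / ((s ^ min p q - 1) / (s - 1)) : ℕ) *
      ((n - (s ^ min p q - 1) / (s - 1) * (n / ((s ^ min p q - 1) / (s - 1))) : ℕ) : ℤ) := by
    positivity
  linarith

lemma not_dvd_of_ne {k : ℕ} (hk : k.Prime) (h : s ≠ k) : ¬ s ∣ k := fun hd =>
  h ((Nat.prime_dvd_prime_iff_eq (Fact.out : s.Prime) hk).1 hd)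

lemma not_dvd_twelve (hs : Odd s) (h3 : s ≠ 3) : ¬ (s : ℤ) ∣ 12 := by
  have hp : s.Prime := Fact.out
  have h2 : s ≠ 2 := by rintro rfl; exact absurd hs (by decide)
  intro h
  have h' : s ∣ 2 * 2 * 3 := by exact_mod_cast h
  rw [hp.dvd_mul, hp.dvd_mul] at h'
  have h2' := not_dvd_of_ne Nat.prime_two h2
  have h3' := not_dvd_of_ne Nat.prime_three h3
  tauto

lemma not_dvd_sixty (hs : Odd s) (h3 : s ≠ 3) (h5 : s ≠ 5) : ¬ (s : ℤ) ∣ 60 := by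
  have hp : s.Prime := Fact.out
  intro h
  have h' : s ∣ 12 * 5 := by exact_mod_cast h
  rw [hp.dvd_mul] at h'
  rcases h' with h' | h'
  · exact not_dvd_twelve hs h3 (by exact_mod_cast h')
  · exact not_dvd_of_ne Nat.prime_five h5 h'

lemma two_ne_zero_of_odd (hs : Odd s) : (2 : ZMod s) ≠ 0 := by
  have hp : s.Prime := Fact.out
  have h2 : s ≠ 2 := by rintro rfl; exact absurd hs (by decide)
  intro h
  have : ((2 : ℕ) : ZMod s) = 0 := by exact_mod_cast h
  exact not_dvd_of_ne Nat.prime_two h2 ((ZMod.natCast_eq_zero_iff _ _).1 this)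

/-- The array generator matrix for `p = q = 2` and three levels. -/
lemma yieldsOptimal_two_two_three (hσ : 0 < σ) :
    YieldsOptimal (s := 3) σ
      !![1, 0, 1, 1, 1;
         0, 1, 2, 1, 2]
      !![1, 0, 2, 1, 2;
         0, 1, 2, 2, 0] (8 / 9) := by
  set Gc : Matrix (Fin 2) (Fin 5) (ZMod 3) := !![1, 0, 1, 1, 1; 0, 1, 2, 1, 2] with hGc
  set Gr : Matrix (Fin 2) (Fin 5) (ZMod 3) := !![1, 0, 2, 1, 2; 0, 1, 2, 2, 0] with hGr
  have hG : FewColumnsIndependent Gc Gr := by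
    -- The only relation among the five columns up to scaling, normalised at the last column; no
    -- entry vanishes.
    refine fewColumnsIndependent_of_null ![1, 1, 2, 2, 1] 4 Finset.univ (by decide) (by decide) ?_
    intro c h1 h2 i
    have a0 := congrFun h1 0
    have a1 := congrFun h1 1
    have b0 := congrFun h2 0
    have b1 := congrFun h2 1
    simp [hGc, hGr, mulVec, dotProduct, Fin.sum_univ_five] at a0 a1 b0 b1
    fin_cases i <;> simp <;> grind
  have hinj : ∀ z w, z ᵥ* Gc + w ᵥ* Gr = 0 → z = 0 ∧ w = 0 := by decide +kernel
  have hA : ∀ i j, Gc i j = ((!![1, 0, 1, 1, 1; 0, 1, 2, 1, 2] : Matrix (Fin 2) (Fin 5) ℤ) i j) := by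
    intro i j
    fin_cases i <;> fin_cases j <;> simp [hGc]
  have hB : ∀ i j, Gr i j = ((!![1, 0, 2, 1, 2; 0, 1, 2, 2, 0] : Matrix (Fin 2) (Fin 5) ℤ) i j) := by
    intro i j
    fin_cases i <;> fin_cases j <;> simp [hGr]
  have hm : ¬ ((3 : ℕ) : ℤ) ∣ 4 := by decide
  have hmain := hG.mainEffectsUnconfounded hσ (exists_entry_ne_zero hA hm (by decide))
    (exists_entry_ne_zero hB hm (by decide))
  have hle := hG.card_le_numUnconfounded hσ (minorPairs
    (!![1, 0, 1, 1, 1; 0, 1, 2, 1, 2] : Matrix (Fin 2) (Fin 5) ℤ)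
    (!![1, 0, 2, 1, 2; 0, 1, 2, 2, 0] : Matrix (Fin 2) (Fin 5) ℤ) 4)
    (fun t ht => (Finset.mem_filter.1 ht).2.1)
    (fun t ht => hasMinor_of_int hA hm (Finset.mem_filter.1 ht).2.2.1)
    (fun t ht => hasMinor_of_int hB hm (Finset.mem_filter.1 ht).2.2.2)
  -- Of the ten pairs two are lost: columns 2 and 4 coincide in the upper block, columns 0 and 4 are
  -- proportional in the lower one.
  have hcard : 8 ≤ (minorPairs (!![1, 0, 1, 1, 1; 0, 1, 2, 1, 2] : Matrix (Fin 2) (Fin 5) ℤ)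
    (!![1, 0, 2, 1, 2; 0, 1, 2, 2, 0] : Matrix (Fin 2) (Fin 5) ℤ) 4).card := by decide +kernel
  have heq : numUnconfounded σ (generatedDesign Gc Gr) = 8 :=
    le_antisymm (numUnconfounded_le_eight hσ hmain) (hcard.trans hle)
  refine ⟨hG.anyFourColumnsIndependent,
    ⟨withoutReplication_generatedDesign hinj, hmain, fun d' _ hd' => ?_⟩, ?_⟩
  · rw [heq]
    exact numUnconfounded_le_eight hσ hd'
  · have hphi : phi 3 2 2 5 = 9 := by decide
    rw [twoFiEfficiency, heq, hphi]
    norm_num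

/-- The array generator matrix for `p = q = 2` and more than three levels. -/
lemma yieldsOptimal_two_two (hσ : 0 < σ) (hs : Odd s) (h3 : s ≠ 3) :
    YieldsOptimal (s := s) σ
      !![1, 0, 1, 1, 1;
         0, 1, 3, 2, 1]
      !![1, 0, 2, 1, 2;
         0, 1, 3, 3, 2] 1 := by
  have h4 : (4 : ZMod s) ≠ 0 := by
    exact_mod_cast intCast_ne_zero_of_dvd (a := 4) (not_dvd_twelve hs h3) (by norm_num)
  refine FewColumnsIndependent.yieldsOptimal_one_of_int hσ le_rfl
    (fewColumnsIndependent_of_null ![1, 4, -1, -1, 1] 4 Finset.univ (by decide) ?_ ?_) ?_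
    (A := !![1, 0, 1, 1, 1; 0, 1, 3, 2, 1]) (B := !![1, 0, 2, 1, 2; 0, 1, 3, 3, 2])
    ?_ ?_ (not_dvd_twelve hs h3) (by decide) (by decide) 10 (by norm_num)
    (phi_le_choose s 2 2 5) (by decide +kernel)
  · intro i _
    fin_cases i <;> simp [h4]
  · intro c h1 h2 i
    have a0 := congrFun h1 0
    have a1 := congrFun h1 1
    have b0 := congrFun h2 0
    have b1 := congrFun h2 1
    simp [mulVec, dotProduct, Fin.sum_univ_five] at a0 a1 b0 b1
    fin_cases i <;> simp <;> grind
  · intro z w h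
    have h0 := congrFun h 0
    have h1 := congrFun h 1
    have h2 := congrFun h 2
    have h3 := congrFun h 3
    simp [vecHead, vecTail] at h0 h1 h2 h3
    constructor <;> ext i <;> fin_cases i <;> simp <;> grind
  · intro i j
    fin_cases i <;> fin_cases j <;> simp
  · intro i j
    fin_cases i <;> fin_cases j <;> simp

/-- The array generator matrix for `p = 2` and `q = 3`. -/
lemma yieldsOptimal_two_three (hσ : 0 < σ) (hs : Odd s) :
    YieldsOptimal (s := s) σ
      !![1, 0, 1, 1, 1, 1;
         0, 1, 2, 1, -2, -1]
      !![1, 0, 2, 1, 1, 0;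
         0, 1, 2, 2, 0, 0;
         0, 0, 0, 0, 1, 1] 1 := by
  have h2 := two_ne_zero_of_odd hs
  set Gc : Matrix (Fin 2) (Fin 6) (ZMod s) := !![1, 0, 1, 1, 1, 1; 0, 1, 2, 1, -2, -1] with hGc
  set Gr : Matrix (Fin 3) (Fin 6) (ZMod s) :=
    !![1, 0, 2, 1, 1, 0; 0, 1, 2, 2, 0, 0; 0, 0, 0, 0, 1, 1] with hGr
  have hG : FewColumnsIndependent Gc Gr := by
    -- Five nonzero entries suffice, so the entry 4 may be left out.
    refine fewColumnsIndependent_of_null ![2, 4, -1, -1, 1, -1] 4 {0, 2, 3, 4, 5} (by decide)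
      (by simp [h2]) ?_
    intro c h1 h2 i
    have a0 := congrFun h1 0
    have a1 := congrFun h1 1
    have b0 := congrFun h2 0
    have b1 := congrFun h2 1
    have b2 := congrFun h2 2
    simp [hGc, hGr, mulVec, dotProduct, Fin.sum_univ_six] at a0 a1 b0 b1 b2
    fin_cases i <;> simp <;> grind
  have hinj : ∀ z w, z ᵥ* Gc + w ᵥ* Gr = 0 → z = 0 ∧ w = 0 := by
    intro z w h
    have h0 := congrFun h 0
    have h1 := congrFun h 1
    have h2 := congrFun h 2
    have h3 := congrFun h 3
    have h5 := congrFun h 5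
    simp [hGc, hGr, vecHead, vecTail] at h0 h1 h2 h3 h5
    constructor <;> ext i <;> fin_cases i <;> simp <;> grind
  have hA : ∀ i j, Gc i j =
      ((!![1, 0, 1, 1, 1, 1; 0, 1, 2, 1, -2, -1] : Matrix (Fin 2) (Fin 6) ℤ) i j) := by
    intro i j
    fin_cases i <;> fin_cases j <;> simp [hGc]
  have hB : ∀ i j, Gr i j = ((!![1, 0, 2, 1, 1, 0; 0, 1, 2, 2, 0, 0; 0, 0, 0, 0, 1, 1] :
      Matrix (Fin 3) (Fin 6) ℤ) i j) := by
    intro i j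
    fin_cases i <;> fin_cases j <;> simp [hGr]
  -- For `s = 3` six columns on four points give `phi = 15 - 2`; for `s ≥ 5` all 15 interactions are
  -- unconfounded.
  by_cases h3 : s = 3
  · subst h3
    exact hG.yieldsOptimal_one_of_int hσ (by norm_num) hinj hA hB (m := 4) (by decide) (by decide)
      (by decide) 13 (by norm_num) (by decide) (by decide +kernel)
  · exact hG.yieldsOptimal_one_of_int hσ (by norm_num) hinj hA hB (not_dvd_twelve hs h3) (by decide)
      (by decide) 15 (by norm_num) (phi_le_choose s 2 3 6) (by decide +kernel)

/-- The array generator matrix for `p = 2` and `q = 4`. -/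
lemma yieldsOptimal_two_four (hσ : 0 < σ) (hs : Odd s) :
    YieldsOptimal (s := s) σ
      !![1, 0, 1, 1, 1, 1, 1;
         0, 1, 2, 1, -1, -2, -3]
      !![1, 0, 2, 1, 0, 0, 0;
         0, 1, 2, 2, 1, 0, 0;
         0, 0, 0, 0, 1, 1, 0;
         0, 0, 0, 0, 1, 2, 1] 1 := by
  set Gc : Matrix (Fin 2) (Fin 7) (ZMod s) :=
    !![1, 0, 1, 1, 1, 1, 1; 0, 1, 2, 1, -1, -2, -3] with hGc
  set Gr : Matrix (Fin 4) (Fin 7) (ZMod s) :=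
    !![1, 0, 2, 1, 0, 0, 0; 0, 1, 2, 2, 1, 0, 0; 0, 0, 0, 0, 1, 1, 0; 0, 0, 0, 0, 1, 2, 1] with hGr
  have hG : FewColumnsIndependent Gc Gr := by
    -- The entries `3` and `-3` are left out, since they vanish for `s = 3`.
    refine fewColumnsIndependent_of_null ![1, 3, 1, -3, 1, -1, 1] 4 {0, 2, 4, 5, 6} (by decide)
      (by simp) ?_
    intro c h1 h2 i
    have a0 := congrFun h1 0
    have a1 := congrFun h1 1
    have b0 := congrFun h2 0
    have b1 := congrFun h2 1
    have b2 := congrFun h2 2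
    have b3 := congrFun h2 3
    simp [hGc, hGr, mulVec, dotProduct, Fin.sum_univ_seven] at a0 a1 b0 b1 b2 b3
    fin_cases i <;> simp <;> grind
  have hinj : ∀ z w, z ᵥ* Gc + w ᵥ* Gr = 0 → z = 0 ∧ w = 0 := by
    intro z w h
    have h0 := congrFun h 0
    have h1 := congrFun h 1
    have h2 := congrFun h 2
    have h3 := congrFun h 3
    have h5 := congrFun h 5
    have h6 := congrFun h 6
    simp [hGc, hGr, vecHead, vecTail] at h0 h1 h2 h3 h5 h6
    constructor <;> ext i <;> fin_cases i <;> simp <;> grind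
  have hA : ∀ i j, Gc i j =
      ((!![1, 0, 1, 1, 1, 1, 1; 0, 1, 2, 1, -1, -2, -3] : Matrix (Fin 2) (Fin 7) ℤ) i j) := by
    intro i j
    fin_cases i <;> fin_cases j <;> simp [hGc]
  have hB : ∀ i j, Gr i j = ((!![1, 0, 2, 1, 0, 0, 0; 0, 1, 2, 2, 1, 0, 0; 0, 0, 0, 0, 1, 1, 0;
      0, 0, 0, 0, 1, 2, 1] : Matrix (Fin 4) (Fin 7) ℤ) i j) := by
    intro i j
    fin_cases i <;> fin_cases j <;> simp [hGr]
  -- Seven columns on `s + 1` points: `phi` is 18 for `s = 3`, 20 for `s = 5` and 21 beyond. The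
  -- test integer `m` is chosen prime to `s` each time.
  by_cases h3 : s = 3
  · subst h3
    exact hG.yieldsOptimal_one_of_int hσ (by norm_num) hinj hA hB (m := 20) (by decide) (by decide)
      (by decide) 18 (by norm_num) (by decide) (by decide +kernel)
  by_cases h5 : s = 5
  · subst h5
    exact hG.yieldsOptimal_one_of_int hσ (by norm_num) hinj hA hB (m := 12) (by decide) (by decide)
      (by decide) 20 (by norm_num) (by decide) (by decide +kernel)
  · exact hG.yieldsOptimal_one_of_int hσ (by norm_num) hinj hA hB (not_dvd_sixty hs h3 h5)
      (by decide) (by decide) 21 (by norm_num) (phi_le_choose s 2 4 7) (by decide +kernel)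

end SmallCases

/-! ### Balanced colourings: edge count and extension. -/

section BalancedColourings

variable {Ω : Type*} [Fintype Ω] [DecidableEq Ω] {s n : ℕ}

/-- A balanced colouring with `s + 1` colours attains Turán's bound. -/
lemma phi_le_card_of_balanced {q : ℕ} (hs : 2 ≤ s) (hq : 2 ≤ q) (hΩ : Fintype.card Ω = s + 1)
    (f : Fin n → Ω)
    (hf : ∀ P, (Finset.univ.filter fun j => f j = P).card = n / (s + 1) ∨
      (Finset.univ.filter fun j => f j = P).card = n / (s + 1) + 1) :
    phi s 2 q n ≤
      (Finset.univ.filter fun t : Fin n × Fin n => t.1 < t.2 ∧ f t.1 ≠ f t.2).card := by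
  set α := n / (s + 1)
  set cnt : Ω → ℕ := fun P => (Finset.univ.filter fun j => f j = P).card
  have hsum : ∑ P, cnt P = n := by
    have := Finset.card_eq_sum_card_fiberwise (s := (Finset.univ : Finset (Fin n)))
      (t := (Finset.univ : Finset Ω)) (f := f) (fun _ _ => Finset.mem_univ _)
    rw [← this, Finset.card_univ, Fintype.card_fin]
  have hsq : ∑ P, cnt P ^ 2 =
      (Finset.univ.filter fun t : Fin n × Fin n => f t.1 = f t.2).card := by
    rw [Finset.card_eq_sum_card_fiberwise (t := (Finset.univ : Finset Ω)) (f := fun t => f t.1)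
      (fun _ _ => Finset.mem_univ _)]
    refine Finset.sum_congr rfl fun P _ => ?_
    rw [pow_two, ← Finset.card_product]
    congr 1
    ext ⟨l, m⟩
    simp only [Finset.mem_product, Finset.mem_filter, Finset.mem_univ, true_and]
    constructor
    · rintro ⟨h1, h2⟩
      exact ⟨h1.trans h2.symm, h1⟩
    · rintro ⟨h1, h2⟩
      exact ⟨h2, h1.symm.trans h2⟩
  set lt := (Finset.univ.filter fun t : Fin n × Fin n => t.1 < t.2 ∧ f t.1 ≠ f t.2)
  have hgt : (Finset.univ.filter fun t : Fin n × Fin n => t.2 < t.1 ∧ f t.1 ≠ f t.2).card =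
      lt.card := by
    refine Finset.card_bij (fun t _ => t.swap) ?_ ?_ ?_
    · rintro ⟨l, m⟩ h
      simpa [lt, ne_comm] using h
    · rintro ⟨l, m⟩ _ ⟨l', m'⟩ _ h
      simpa [and_comm] using h
    · rintro ⟨l, m⟩ h
      exact ⟨(m, l), by simpa [lt, ne_comm] using h, rfl⟩
  have htot : (Finset.univ.filter fun t : Fin n × Fin n => f t.1 = f t.2).card + 2 * lt.card =
      n * n := by
    have h1 : (Finset.univ.filter fun t : Fin n × Fin n => ¬ f t.1 = f t.2) = lt ∪
        Finset.univ.filter fun t : Fin n × Fin n => t.2 < t.1 ∧ f t.1 ≠ f t.2 := by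
      ext ⟨l, m⟩
      simp only [lt, Finset.mem_filter, Finset.mem_univ, true_and, Finset.mem_union, ← or_and_right]
      refine ⟨fun h => ⟨lt_or_gt_of_ne fun hlm => h (by rw [hlm]), h⟩, fun h => h.2⟩
    have h2 : Disjoint lt
        (Finset.univ.filter fun t : Fin n × Fin n => t.2 < t.1 ∧ f t.1 ≠ f t.2) := by
      rw [Finset.disjoint_filter]
      exact fun t _ h h' => h.1.asymm h'.1
    have h3 := Finset.card_filter_add_card_filter_not (s := (Finset.univ : Finset (Fin n × Fin n)))
      (fun t => f t.1 = f t.2)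
    rw [h1, Finset.card_union_of_disjoint h2, hgt, Finset.card_univ, Fintype.card_prod,
      Fintype.card_fin] at h3
    omega
  -- Since `cnt P` is `α` or `α + 1`, its square is linear in it; so the number of monochromatic
  -- pairs depends only on `n` and `s`.
  have hcnt : ∀ P, (cnt P : ℤ) ^ 2 = (2 * α + 1) * cnt P - α * (α + 1) := by
    intro P
    have h0 : cnt P = α ∨ cnt P = α + 1 := hf P
    rcases h0 with h | h <;> rw [h] <;> push_cast <;> ring
  have hsq' : (∑ P, (cnt P : ℤ) ^ 2) = (2 * α + 1) * n - (s + 1) * (α * (α + 1)) := by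
    simp only [hcnt, Finset.sum_sub_distrib, ← Finset.mul_sum, Finset.sum_const, Finset.card_univ,
      hΩ, nsmul_eq_mul]
    rw [← Nat.cast_sum, hsum]
    push_cast
    ring
  have hphi := two_mul_phi (n := n) hs hq
  have hdm : (n : ℤ) = (s + 1) * α + (n % (s + 1) : ℕ) := by
    exact_mod_cast (Nat.div_add_mod n (s + 1)).symm
  rw [← hsq] at htot
  zify at htot
  rw [hsq'] at htot
  set β := n % (s + 1)
  rw [hdm] at htot hphi
  refine le_of_mul_le_mul_left (le_of_eq ?_) (zero_lt_two' ℤ)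
  rw [hphi]
  linear_combination -htot

/-- Balanced multiplicities stay balanced when a point of least multiplicity is added. -/
lemma exists_balanced_succ {N : ℕ} (hΩ : Fintype.card Ω = N) (hN : 0 < N) (f : Ω → ℕ)
    (hsum : ∑ P, f P = n) (hf : ∀ P, f P = n / N ∨ f P = n / N + 1) :
    ∃ Q, ∀ P, f P + (if Q = P then 1 else 0) = (n + 1) / N ∨
      f P + (if Q = P then 1 else 0) = (n + 1) / N + 1 := by
  have hdm := Nat.div_add_mod n N
  have hlt := Nat.mod_lt n hN
  set a := n / N
  obtain ⟨Q, hQ⟩ : ∃ Q, f Q = a := by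
    by_contra! hall
    have h1 : ∑ P, f P = N * (a + 1) := by
      rw [Finset.sum_congr rfl fun P _ => (hf P).resolve_left (hall P)]
      simp [hΩ]
    rw [h1, mul_add] at hsum
    omega
  refine ⟨Q, fun P => ?_⟩
  -- The quotient increases only in this case, and then `Q` must be the only point of multiplicity
  -- `a`.
  by_cases hlast : n % N = N - 1
  · have hdiv : (n + 1) / N = a + 1 := by
      rw [show n + 1 = N * (a + 1) by rw [mul_add]; omega]
      exact Nat.mul_div_cancel_left _ hN
    rw [hdiv]
    by_cases hP : Q = P
    · subst hP; simp [hQ]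
    · left
      simp only [hP, if_false, add_zero]
      by_contra hne
      have hPa : f P = a := (hf P).resolve_right hne
      -- With a second point `P` of multiplicity `a` this would give `n + 2 ≤ N * (a + 1) = n + 1`.
      have h2 : ∑ R, (f R + ((if Q = R then 1 else 0) + if P = R then 1 else 0)) ≤
          ∑ _R : Ω, (a + 1) := by
        refine Finset.sum_le_sum fun R _ => ?_
        by_cases h1 : Q = R
        · subst h1; simp [hQ, Ne.symm hP]
        · by_cases h2 : P = R
          · subst h2; simp [hPa, h1]
          · simp only [h1, h2, if_false]
            rcases hf R with h | h <;> omega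
      simp only [Finset.sum_add_distrib, Finset.sum_ite_eq, Finset.mem_univ, if_true, hsum,
        Finset.sum_const, Finset.card_univ, hΩ, smul_eq_mul, mul_one] at h2
      omega
  · have hdiv : (n + 1) / N = a := by
      rw [← hdm, add_assoc, Nat.mul_add_div hN, Nat.div_eq_of_lt (by omega), add_zero]
    rw [hdiv]
    by_cases hP : Q = P
    · subst hP; simp [hQ]
    · simpa [hP] using hf P

/-- Balanced multiplicities can be extended to balanced multiplicities of any larger total. -/
lemma exists_balanced_extension {N : ℕ} (hΩ : Fintype.card Ω = N) (hN : 0 < N) (f : Ω → ℕ)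
    (hsum : ∑ P, f P = n) (hf : ∀ P, f P = n / N ∨ f P = n / N + 1) (r : ℕ) :
    ∃ y : Fin r → Ω, ∀ P, f P + ∑ j, (if y j = P then 1 else 0) = (n + r) / N ∨
      f P + ∑ j, (if y j = P then 1 else 0) = (n + r) / N + 1 := by
  induction r with
  | zero => exact ⟨Fin.elim0, by simpa using hf⟩
  | succ r ih =>
    obtain ⟨y, hy⟩ := ih
    obtain ⟨Q, hQ⟩ := exists_balanced_succ (n := n + r) hΩ hN
      (fun P => f P + ∑ j, if y j = P then 1 else 0) (by
        rw [Finset.sum_add_distrib, hsum, Finset.sum_comm]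
        simp) hy
    refine ⟨Fin.snoc y Q, fun P => ?_⟩
    simp only [Fin.sum_univ_castSucc, Fin.snoc_castSucc, Fin.snoc_last]
    rw [← add_assoc, ← add_assoc]
    exact hQ P

end BalancedColourings

/-! ### Points of the projective line. -/

section ProjectiveLine

variable {s : ℕ} [Fact s.Prime]

lemma mk_eq_mk_iff_det {v w : Fin 2 → ZMod s} (hv : v ≠ 0) (hw : w ≠ 0) :
    Projectivization.mk (ZMod s) v hv = Projectivization.mk (ZMod s) w hw ↔
      v 0 * w 1 - v 1 * w 0 = 0 := by
  rw [Projectivization.mk_eq_mk_iff']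
  constructor
  · rintro ⟨a, rfl⟩
    simp
    ring
  · intro h
    obtain ⟨i, hi⟩ := Function.ne_iff.1 hw
    refine ⟨v i / w i, ?_⟩
    simp only [Pi.zero_apply] at hi
    funext j
    simp only [Pi.smul_apply, smul_eq_mul]
    rw [div_mul_eq_mul_div, div_eq_iff hi]
    fin_cases i <;> fin_cases j <;> simp <;>
      first | ring1 | linear_combination h | linear_combination -h

lemma pointCount_eq_sum [DecidableEq (Projectivization (ZMod s) (Fin 2 → ZMod s))] {m : ℕ}
    {A : Matrix (Fin 2) (Fin m) (ZMod s)} (hA : ∀ j, A.col j ≠ 0)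
    (P : Projectivization (ZMod s) (Fin 2 → ZMod s)) :
    pointCount A P =
      (Finset.univ.filter fun j => Projectivization.mk (ZMod s) (A.col j) (hA j) = P).card := by
  rw [pointCount, ← Set.ncard_coe_finset]
  congr 1
  ext j
  simp [hA]

lemma card_projectiveLine [Fintype (Projectivization (ZMod s) (Fin 2 → ZMod s))] :
    Fintype.card (Projectivization (ZMod s) (Fin 2 → ZMod s)) = s + 1 := by
  rw [← Nat.card_eq_fintype_card, Projectivization.card_of_finrank_two _ _ (by simp),
    Nat.card_zmod]

end ProjectiveLine

/-! ### The matrices for `q ≥ 5`. -/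

section LargeCase

variable {s r : ℕ}

@[simp]
lemma upperBlock_castAdd (X : Matrix (Fin 2) (Fin r) (ZMod s)) (i : Fin 2) (j : Fin 5) :
    upperBlock X i (Fin.castAdd r j) =
      (!![1, 0, 1, 1, 1; 0, 1, 2, 1, -1] : Matrix (Fin 2) (Fin 5) (ZMod s)) i j := by
  simp [upperBlock]

@[simp]
lemma upperBlock_natAdd (X : Matrix (Fin 2) (Fin r) (ZMod s)) (i : Fin 2) (j : Fin r) :
    upperBlock X i (Fin.natAdd 5 j) = X i j := by
  simp [upperBlock]

@[simp]
lemma lowerBlock_castAdd_castAdd (i : Fin 2) (j : Fin 5) :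
    lowerBlock s r (Fin.castAdd r i) (Fin.castAdd r j) =
      (!![1, 0, 2, 1, 1; 0, 1, 2, 2, -1] : Matrix (Fin 2) (Fin 5) (ZMod s)) i j := by
  simp [lowerBlock]

@[simp]
lemma lowerBlock_castAdd_natAdd (i : Fin 2) (j : Fin r) :
    lowerBlock s r (Fin.castAdd r i) (Fin.natAdd 5 j) = 0 := by
  simp [lowerBlock]

@[simp]
lemma lowerBlock_natAdd_castAdd (i : Fin r) (j : Fin 5) :
    lowerBlock s r (Fin.natAdd 2 i) (Fin.castAdd r j) = (![0, 0, 0, 0, 1] : Fin 5 → ZMod s) j := by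
  simp [lowerBlock]

@[simp]
lemma lowerBlock_natAdd_natAdd (i j : Fin r) :
    lowerBlock s r (Fin.natAdd 2 i) (Fin.natAdd 5 j) = if i = j then 1 else 0 := by
  simp [lowerBlock, Matrix.one_apply]

/-- Over three levels, each direction occurs once or twice among the first five columns. -/
lemma card_proportional_three : ∀ v : Fin 2 → ZMod 3, v ≠ 0 →
    (Finset.univ.filter fun j => (!![1, 0, 1, 1, 1; 0, 1, 2, 1, -1] :
      Matrix (Fin 2) (Fin 5) (ZMod 3)) 0 j * v 1 - (!![1, 0, 1, 1, 1; 0, 1, 2, 1, -1] :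
      Matrix (Fin 2) (Fin 5) (ZMod 3)) 1 j * v 0 = 0).card = 5 / (3 + 1) ∨
    (Finset.univ.filter fun j => (!![1, 0, 1, 1, 1; 0, 1, 2, 1, -1] :
      Matrix (Fin 2) (Fin 5) (ZMod 3)) 0 j * v 1 - (!![1, 0, 1, 1, 1; 0, 1, 2, 1, -1] :
      Matrix (Fin 2) (Fin 5) (ZMod 3)) 1 j * v 0 = 0).card = 5 / (3 + 1) + 1 := by
  decide +kernel

variable [Fact s.Prime]

/-- The last `r` rows make the coefficients of the identity columns equal to minus that of column 4,
and the four other equations determine the rest. So all relations are multiples of `N`, in which `u`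
and `w` are the row sums of `X`. -/
lemma fewColumnsIndependent_blocks (hr : 3 ≤ r) (X : Matrix (Fin 2) (Fin r) (ZMod s)) :
    FewColumnsIndependent (upperBlock X) (lowerBlock s r) := by
  classical
  set u := ∑ j, X 0 j with hu
  set w := ∑ j, X 1 j with hw
  set N : Fin (5 + r) → ZMod s :=
    Fin.append ![2 * u + w - 1, 2 * u + 2 * w + 1, -u, -w, 1] (fun _ => -1) with hN
  have hN5 : ∀ j : Fin 5, N (Fin.castAdd r j) =
      ![2 * u + w - 1, 2 * u + 2 * w + 1, -u, -w, 1] j := fun j => by simp [hN]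
  have hNr : ∀ j : Fin r, N (Fin.natAdd 5 j) = -1 := fun j => by simp [hN]
  -- If `u = w = 0`, entry 0 is `-1`. Together with column 4 and the `r ≥ 3` entries `-1` this makes
  -- at least five nonzero entries.
  obtain ⟨a, ha4, ha⟩ : ∃ a : Fin 5, a ≠ 4 ∧ N (Fin.castAdd r a) ≠ 0 := by
    by_contra! h
    have h0 := h 0 (by decide)
    have h2 := h 2 (by decide)
    have h3 := h 3 (by decide)
    rw [hN5] at h0 h2 h3
    simp at h0 h2 h3
    simp [h2, h3] at h0
  refine fewColumnsIndependent_of_null N (Fin.castAdd r 4)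
    (insert (Fin.castAdd r a) (insert (Fin.castAdd r 4) (Finset.univ.map (Fin.natAddEmb 5))))
    ?_ ?_ ?_
  · rw [Finset.card_insert_of_notMem, Finset.card_insert_of_notMem, Finset.card_map,
      Finset.card_univ, Fintype.card_fin]
    · omega
    · simp [Fin.ext_iff]
      omega
    · simp [Fin.ext_iff]
      refine ⟨fun h => ha4 (Fin.ext h), fun x => ?_⟩
      omega
  · intro i hi
    simp only [Finset.mem_insert, Finset.mem_map, Finset.mem_univ, true_and] at hi
    rcases hi with rfl | rfl | ⟨j, rfl⟩
    · exact ha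
    · rw [hN5]; simp
    · rw [Fin.natAddEmb_apply, hNr]; simp
  · intro c h1 h2
    have hbot : ∀ k : Fin r, c (Fin.natAdd 5 k) = -c (Fin.castAdd r 4) := by
      intro k
      have h := congrFun h2 (Fin.natAdd 2 k)
      simp [mulVec, dotProduct, Fin.sum_univ_add, Fin.sum_univ_five] at h
      linear_combination h
    have a0 := congrFun h1 0
    have a1 := congrFun h1 1
    have b0 := congrFun h2 (Fin.castAdd r 0)
    have b1 := congrFun h2 (Fin.castAdd r 1)
    simp only [mulVec, dotProduct, Fin.sum_univ_add, upperBlock_castAdd, upperBlock_natAdd,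
      lowerBlock_castAdd_castAdd, lowerBlock_castAdd_natAdd, hbot, ← Finset.sum_mul,
      Fin.sum_univ_five, ← hu, ← hw] at a0 a1 b0 b1
    simp at a0 a1 b0 b1
    have c2 : c (Fin.castAdd r 2) = -u * c (Fin.castAdd r 4) := by linear_combination b0 - a0
    have c3 : c (Fin.castAdd r 3) = -w * c (Fin.castAdd r 4) := by linear_combination b1 - a1
    intro i
    refine Fin.addCases (fun j => ?_) (fun j => ?_) i
    · rw [hN5]
      fin_cases j
      · simp; linear_combination b0 - 2 * c2 - c3
      · simp; linear_combination b1 - 2 * c2 - 2 * c3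
      · simpa using c2
      · simpa using c3
      · simp
    · rw [hNr, hbot]
      ring

lemma eq_zero_of_vecMul_blocks (X : Matrix (Fin 2) (Fin r) (ZMod s)) (z : Fin 2 → ZMod s)
    (w : Fin (2 + r) → ZMod s) (h : z ᵥ* upperBlock X + w ᵥ* lowerBlock s r = 0) :
    z = 0 ∧ w = 0 := by
  have h0 := congrFun h (Fin.castAdd r 0)
  have h1 := congrFun h (Fin.castAdd r 1)
  have h2 := congrFun h (Fin.castAdd r 2)
  have h3 := congrFun h (Fin.castAdd r 3)
  simp [vecMul, dotProduct, Fin.sum_univ_add, Fin.sum_univ_two] at h0 h1 h2 h3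
  have z0 : z 0 = 0 := by linear_combination 2 * h0 + 2 * h1 - h2
  have z1 : z 1 = 0 := by linear_combination h0 + 2 * h1 - h3
  have w0 : w (Fin.castAdd r 0) = 0 := by linear_combination h0 - z0
  have w1 : w (Fin.castAdd r 1) = 0 := by linear_combination h1 - z1
  have hz : z = 0 := by
    funext i
    fin_cases i
    exacts [z0, z1]
  refine ⟨hz, funext fun i => Fin.addCases (fun j => ?_) (fun j => ?_) i⟩
  · fin_cases j
    exacts [w0, w1]
  · have hj := congrFun h (Fin.natAdd 5 j)
    simpa [hz, vecMul, dotProduct, Fin.sum_univ_add] using hj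

/-- Thus the lower block costs no interaction. Columns 0 to 3 are distinct points in the top two
rows; column 4 is nonzero in the third row, where those vanish; the identity columns vanish in the
top two rows, where the first five do not. -/
lemma hasMinor_lowerBlock (hs : (2 : ZMod s) ≠ 0) (hr : 0 < r) {l m : Fin (5 + r)} (hlm : l < m) :
    HasMinor (lowerBlock s r) l m := by
  have hcol : ∀ j : Fin 5, ∃ i : Fin 2,
      (!![1, 0, 2, 1, 1; 0, 1, 2, 2, -1] : Matrix (Fin 2) (Fin 5) (ZMod s)) i j ≠ 0 := by
    intro j
    fin_cases j
    exacts [⟨0, by simp⟩, ⟨1, by simp⟩, ⟨0, by simpa using hs⟩, ⟨0, by simp⟩, ⟨0, by simp⟩]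
  induction l using Fin.addCases with
  | left l =>
    induction m using Fin.addCases with
    | left m =>
      have hlm' : l < m := hlm
      by_cases hm : m = 4
      · subst hm
        obtain ⟨i, hi⟩ := hcol l
        refine ⟨Fin.castAdd r i, Fin.natAdd 2 ⟨0, hr⟩, ?_⟩
        rw [lowerBlock_castAdd_castAdd, lowerBlock_natAdd_castAdd, lowerBlock_natAdd_castAdd]
        have hl : (![0, 0, 0, 0, 1] : Fin 5 → ZMod s) l = 0 := by
          fin_cases l <;> first | rfl | exact absurd hlm' (by decide)
        rw [hl]
        simpa using hi
      · refine ⟨Fin.castAdd r 0, Fin.castAdd r 1, ?_⟩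
        simp only [lowerBlock_castAdd_castAdd]
        fin_cases l <;> fin_cases m <;> first
          | exact absurd hlm' (by decide)
          | exact absurd rfl hm
          | (simp; done)
          | (simpa using hs)
          | (simp; intro h; apply hs; linear_combination h)
    | right m =>
      obtain ⟨i, hi⟩ := hcol l
      refine ⟨Fin.castAdd r i, Fin.natAdd 2 m, ?_⟩
      simpa using hi
  | right l =>
    induction m using Fin.addCases with
    | left m =>
      exact absurd hlm (by simp [Fin.lt_def]; omega)
    | right m =>
      have hlm' : l ≠ m := fun h => by simp [h] at hlm
      refine ⟨Fin.natAdd 2 l, Fin.natAdd 2 m, ?_⟩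
      simp [hlm']

lemma col_upperBlock_ne_zero {X : Matrix (Fin 2) (Fin r) (ZMod s)} (hX : ∀ j, X.col j ≠ 0)
    (j : Fin (5 + r)) : (upperBlock X).col j ≠ 0 := by
  induction j using Fin.addCases with
  | left j =>
    intro h
    have h0 := congrFun h 0
    have h1 := congrFun h 1
    simp only [Matrix.col_apply, upperBlock_castAdd] at h0 h1
    fin_cases j <;> simp at h0 h1
  | right j =>
    intro h
    apply hX j
    funext i
    simpa using congrFun h i

variable {σ : ℝ}

/-- The array generator matrices for `p = 2` and `q = 2 + r ≥ 5`. -/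
lemma IsAdmissible.yieldsOptimal (hσ : 0 < σ) (hs : Odd s) (hr : 3 ≤ r)
    {X : Matrix (Fin 2) (Fin r) (ZMod s)} (hX : IsAdmissible X) :
    YieldsOptimal σ (upperBlock X) (lowerBlock s r) 1 := by
  classical
  have := Fintype.ofFinite (Projectivization (ZMod s) (Fin 2 → ZMod s))
  have h2 := two_ne_zero_of_odd hs
  have hs2 : 2 ≤ s := (Fact.out : s.Prime).two_le
  have hcol := col_upperBlock_ne_zero hX.1
  -- Factors are coloured by the points of their upper columns; different colours mean a nonzero
  -- upper minor.
  set f : Fin (5 + r) → Projectivization (ZMod s) (Fin 2 → ZMod s) := fun j =>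
    Projectivization.mk (ZMod s) ((upperBlock X).col j) (hcol j) with hf
  have hne : ∀ l m, f l ≠ f m ↔ upperBlock X 0 l * upperBlock X 1 m -
      upperBlock X 1 l * upperBlock X 0 m ≠ 0 := fun l m =>
    not_congr (mk_eq_mk_iff_det (hcol l) (hcol m))
  refine (fewColumnsIndependent_blocks hr X).yieldsOptimal_one hσ (by omega)
    (eq_zero_of_vecMul_blocks X) (fun l => ?_) (fun l => ?_)
    (Finset.univ.filter fun t => t.1 < t.2 ∧ f t.1 ≠ f t.2)
    (fun t ht => (Finset.mem_filter.1 ht).2.1)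
    (fun t ht => ⟨0, 1, (hne _ _).1 (Finset.mem_filter.1 ht).2.2⟩)
    (fun t ht => hasMinor_lowerBlock h2 (by omega) (Finset.mem_filter.1 ht).2.1)
    (phi_le_card_of_balanced hs2 (by omega) card_projectiveLine f fun P => ?_)
    ⟨(Fin.castAdd r 0, Fin.castAdd r 1), ?_⟩
  · exact Function.ne_iff.1 (hcol l)
  · induction l using Fin.addCases with
    | left l =>
      fin_cases l
      exacts [⟨Fin.castAdd r 0, by simp⟩, ⟨Fin.castAdd r 1, by simp⟩,
        ⟨Fin.castAdd r 0, by simpa using h2⟩, ⟨Fin.castAdd r 0, by simp⟩,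
        ⟨Fin.castAdd r 0, by simp⟩]
    | right l => exact ⟨Fin.natAdd 2 l, by simp⟩
  · rw [← pointCount_eq_sum hcol]
    exact hX.2 P
  · rw [Finset.mem_filter, hne]
    refine ⟨Finset.mem_univ _, by simp [Fin.lt_def], by simp⟩

/-- The first five columns of the upper block are balanced. -/
lemma pointCount_firstColumns (hs : Odd s) (P : Projectivization (ZMod s) (Fin 2 → ZMod s)) :
    pointCount (!![1, 0, 1, 1, 1; 0, 1, 2, 1, -1] : Matrix (Fin 2) (Fin 5) (ZMod s)) P =
      5 / (s + 1) ∨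
    pointCount (!![1, 0, 1, 1, 1; 0, 1, 2, 1, -1] : Matrix (Fin 2) (Fin 5) (ZMod s)) P =
      5 / (s + 1) + 1 := by
  classical
  set A : Matrix (Fin 2) (Fin 5) (ZMod s) := !![1, 0, 1, 1, 1; 0, 1, 2, 1, -1] with hA
  have hAcol : ∀ j, A.col j ≠ 0 := by
    intro j h
    have h0 := congrFun h 0
    have h1 := congrFun h 1
    simp only [Matrix.col_apply, hA] at h0 h1
    fin_cases j <;> simp at h0 h1
  rw [pointCount_eq_sum hAcol]
  by_cases h3 : s = 3
  · subst h3
    rw [← P.mk_rep]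
    have hdet : ∀ j, Projectivization.mk (ZMod 3) (A.col j) (hAcol j) =
        Projectivization.mk (ZMod 3) P.rep P.rep_nonzero ↔
        A 0 j * P.rep 1 - A 1 j * P.rep 0 = 0 := fun j => mk_eq_mk_iff_det _ _
    simp only [hdet]
    exact card_proportional_three P.rep P.rep_nonzero
  -- For `s ≥ 5` the quotient is zero and the five points are distinct, because all minors divide
  -- 12.
  · have hs5 : 5 < s + 1 := by
      have h2 := (Fact.out : s.Prime).two_le
      obtain ⟨k, hk⟩ := hs
      omega
    rw [Nat.div_eq_of_lt hs5, zero_add, ← Nat.le_one_iff_eq_zero_or_eq_one, Finset.card_le_one]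
    intro j hj j' hj'
    rw [Finset.mem_filter] at hj hj'
    have hdet := (mk_eq_mk_iff_det (hAcol j) (hAcol j')).1 (hj.2.trans hj'.2.symm)
    simp only [Matrix.col_apply] at hdet
    by_contra hne
    have hint : ∀ i j, A i j =
        ((!![1, 0, 1, 1, 1; 0, 1, 2, 1, -1] : Matrix (Fin 2) (Fin 5) ℤ) i j) := by
      intro i j
      fin_cases i <;> fin_cases j <;> simp [hA]
    have hdvd : ∀ j j' : Fin 5, j ≠ j' →
        (!![1, 0, 1, 1, 1; 0, 1, 2, 1, -1] : Matrix (Fin 2) (Fin 5) ℤ) 0 j *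
          (!![1, 0, 1, 1, 1; 0, 1, 2, 1, -1] : Matrix (Fin 2) (Fin 5) ℤ) 1 j' -
        (!![1, 0, 1, 1, 1; 0, 1, 2, 1, -1] : Matrix (Fin 2) (Fin 5) ℤ) 1 j *
          (!![1, 0, 1, 1, 1; 0, 1, 2, 1, -1] : Matrix (Fin 2) (Fin 5) ℤ) 0 j' ∣ 12 := by
      decide
    simp only [hint] at hdet
    exact intCast_ne_zero_of_dvd (not_dvd_twelve hs h3) (hdvd j j' hne) (by exact_mod_cast hdet)

lemma sum_pointCount {m : ℕ} [Fintype (Projectivization (ZMod s) (Fin 2 → ZMod s))]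
    {A : Matrix (Fin 2) (Fin m) (ZMod s)} (hA : ∀ j, A.col j ≠ 0) : ∑ P, pointCount A P = m := by
  classical
  simp only [pointCount_eq_sum hA]
  rw [← Finset.card_eq_sum_card_fiberwise (f := fun j => Projectivization.mk (ZMod s) (A.col j) (hA j))
    (fun _ _ => Finset.mem_univ _), Finset.card_univ,
    Fintype.card_fin]

/-- There is an admissible choice of the remaining columns. -/
lemma exists_isAdmissible (hs : Odd s) (r : ℕ) :
    ∃ X : Matrix (Fin 2) (Fin r) (ZMod s), IsAdmissible X := by
  classical
  have := Fintype.ofFinite (Projectivization (ZMod s) (Fin 2 → ZMod s))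
  set A : Matrix (Fin 2) (Fin 5) (ZMod s) := !![1, 0, 1, 1, 1; 0, 1, 2, 1, -1] with hA
  have hAcol : ∀ j, A.col j ≠ 0 := by
    intro j h
    have h0 := congrFun h 0
    have h1 := congrFun h 1
    simp only [Matrix.col_apply, hA] at h0 h1
    fin_cases j <;> simp at h0 h1
  -- Points of least multiplicity are added one by one to the balanced first five; representatives
  -- of them form `X`.
  obtain ⟨y, hy⟩ := exists_balanced_extension card_projectiveLine (Nat.succ_pos s) (pointCount A)
    (sum_pointCount hAcol) (pointCount_firstColumns hs) r
  have hX : ∀ j, (Matrix.of fun i j => (y j).rep i : Matrix (Fin 2) (Fin r) (ZMod s)).col j ≠ 0 :=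
    fun j => (y j).rep_nonzero
  refine ⟨Matrix.of fun i j => (y j).rep i, hX, fun P => ?_⟩
  have hcount : pointCount (upperBlock (Matrix.of fun i j => (y j).rep i)) P =
      pointCount A P + ∑ j, if y j = P then 1 else 0 := by
    rw [pointCount_eq_sum (col_upperBlock_ne_zero hX), pointCount_eq_sum hAcol,
      Finset.card_filter, Finset.card_filter, Fin.sum_univ_add]
    have h1 : ∀ (j : Fin 5) h, Projectivization.mk (ZMod s)
        ((upperBlock (Matrix.of fun i j => (y j).rep i)).col (Fin.castAdd r j)) h =
        Projectivization.mk (ZMod s) (A.col j) (hAcol j) := by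
      intro j h
      congr 1
      funext i
      simp [hA]
    have h2 : ∀ (j : Fin r) h, Projectivization.mk (ZMod s)
        ((upperBlock (Matrix.of fun i j => (y j).rep i)).col (Fin.natAdd 5 j)) h = y j := by
      intro j h
      conv_rhs => rw [← (y j).mk_rep]
      congr 1
      funext i
      simp
    simp only [h1, h2]
  rw [hcount]
  exact hy P

end LargeCase

end FactorialDesign

theorem theorem10 (s : ℕ) [Fact s.Prime] (hs : Odd s) (σ : ℝ) (hσ : 0 < σ) :
    -- `p = q = 2`, `n = 5`, `s = 3`
    (s = 3 →
      FactorialDesign.YieldsOptimal (s := s) σ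
        !![1, 0, 1, 1, 1;
           0, 1, 2, 1, 2]
        !![1, 0, 2, 1, 2;
           0, 1, 2, 2, 0] (8 / 9)) ∧
    -- `p = q = 2`, `n = 5`, `s ≠ 3`
    (s ≠ 3 →
      FactorialDesign.YieldsOptimal (s := s) σ
        !![1, 0, 1, 1, 1;
           0, 1, 3, 2, 1]
        !![1, 0, 2, 1, 2;
           0, 1, 3, 3, 2] 1) ∧
    -- `p = 2`, `q = 3`, `n = 6`
    FactorialDesign.YieldsOptimal (s := s) σ
      !![1, 0, 1, 1, 1, 1;
         0, 1, 2, 1, -2, -1]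
      !![1, 0, 2, 1, 1, 0;
         0, 1, 2, 2, 0, 0;
         0, 0, 0, 0, 1, 1] 1 ∧
    -- `p = 2`, `q = 4`, `n = 7`
    FactorialDesign.YieldsOptimal (s := s) σ
      !![1, 0, 1, 1, 1, 1, 1;
         0, 1, 2, 1, -1, -2, -3]
      !![1, 0, 2, 1, 0, 0, 0;
         0, 1, 2, 2, 1, 0, 0;
         0, 0, 0, 0, 1, 1, 0;
         0, 0, 0, 0, 1, 2, 1] 1 ∧
    -- `p = 2`, `q = 2 + r ≥ 5`, `n = 5 + r`
    ∀ r : ℕ, 3 ≤ r →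
      (∃ X : Matrix (Fin 2) (Fin r) (ZMod s), FactorialDesign.IsAdmissible X) ∧
      ∀ X : Matrix (Fin 2) (Fin r) (ZMod s), FactorialDesign.IsAdmissible X →
        FactorialDesign.YieldsOptimal σ (FactorialDesign.upperBlock X)
          (FactorialDesign.lowerBlock s r) 1 := by
  refine ⟨?_, fun h3 => FactorialDesign.yieldsOptimal_two_two hσ hs h3,
    FactorialDesign.yieldsOptimal_two_three hσ hs, FactorialDesign.yieldsOptimal_two_four hσ hs,
    fun r hr => ⟨FactorialDesign.exists_isAdmissible hs r, fun X hX => hX.yieldsOptimal hσ hs hr⟩⟩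
  rintro rfl
  exact FactorialDesign.yieldsOptimal_two_two_three hσ
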